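/- All vector spaces are real and finite-dimensional. **Constant Courant algebroids.** A Courant algebroid structure on the trivial bundle $W_1\times W_0\to W_0$ consists of a smooth fibrewise nondegenerate symmetric bilinear form $\langle\cdot,\cdot\rangle$, a smooth bundle map (anchor) $\rho$ to $TW_0=W_0\times W_0$, and a bilinear bracket on smooth sections such that, for all sections $e_i$ and smooth functions $f$: (1) $[e_1,fe_2]=\rho(e_1)(f)e_2+f[e_1,e_2]$; (2) $\rho(e_1)\langle e_2,e_3\rangle=\langle[e_1,e_2],e_3\rangle+\langle e_2,[e_1,e_3]\rangle$; (3) $[[e_1,e_2],e_3]=[e_1,[e_2,e_3]]-[e_2,[e_1,e_3]]$; (4) $[e_1,e_2]+[e_2,e_1]=\mathcal D\langle e_1,e_2\rangle$, where $\langle\mathcal Df,e\rangle=\rho(e)(f)$. It is *constant* if the pairing and the anchor are independent of the basepoint and the bracket of constant sections vanishes. Isomorphisms of constant Courant algebroids are pairs of linear isomorphisms of $W_1$ and of $W_0$ preserving pairing, anchor and bracket. **Constant symplectic 2-groupoids.** A linear 2-groupoid is a simplicial vector space $V_\bullet$, with faces $f_i$ and degeneracies $\sigma_i$, whose horn maps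 $\lambda_{q,k}:V_q\to\Lambda_{q,k}V$ are surjective for $q\ge1$ and bijective for $q>2$. Put $\hat T_q=V_q/\sum_i\sigma_i(V_{q-1})$, and let $\partial:\hat T_1\to V_0$ be induced by $f_0-f_1$. A 2-form $\alpha$ on $V_q$ is multiplicative if $\delta\alpha=\sum_i(-1)^if_i^*\alpha=0$ and normalized if $\sigma_i^*\alpha=0$ for all $i$. A normalized 2-form $\omega$ on $V_2$ induces, at each $x\in V_0$, a pairing $A_\omega(v,w)=\omega(\sigma_0\sigma_0v,w)$ of $V_0$ with $\hat T_2$ and a symmetric form $B_\omega(\theta,\eta)=\omega(\sigma_1\theta,\sigma_0\eta)+\omega(\sigma_1\eta,\sigma_0\theta)$ on $\hat T_1$ (with $\omega$ evaluated at $\sigma_0\sigma_0x$); $\omega$ is simplicially nondegenerate if $A_\omega$ and $B_\omega$ are nondegenerate at all $x$. A constant symplectic 2-groupoid is a linear 2-groupoid $V_\bullet$ with a closed, multiplicative, normalized, simplicially nondegenerate 2-form $\omega$ on $V_2$ that is constant. Two such forms $\omega,\omega'$ on the same $V_\bullet$ are equivalent if $\omega'-\omega=\delta\alpha$ for a closed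 normalized (smooth, not necessarily constant) 2-form $\alpha$ on $V_1$ with $A_{\delta\alpha}=B_{\delta\alpha}=0$. Constant symplectic 2-groupoids $(V_\bullet,\omega)$, $(V'_\bullet,\omega')$ are equivalent if there is an isomorphism $\varphi:V_\bullet\to V'_\bullet$ of simplicial vector spaces such that $\omega$ is equivalent to $\varphi^*\omega'$. **Theorem 4.3.** There is a one-to-one correspondence between constant Courant algebroids and equivalence classes of constant symplectic 2-groupoids. Precisely: (a) Let $W_1,W_0$ be vector spaces. Then there are bijections between the following three sets: the constant Courant algebroid structures on $W_1\times W_0\to W_0$; the pairs $(\langle\cdot,\cdot\rangle,\partial)$ of a nondegenerate symmetric bilinear form on $W_1$ and a linear map $\partial:W_1\to W_0$ with $\partial\circ\partial^*=0$, where $\partial^*:W_0^*\to W_1^*\cong W_1$; and the constant symplectic 2-groupoids with given identifications $\hat T_1\cong W_1$, $V_0\cong W_0$, modulo equivalences that are compatible with these identifications. The first bijection sends a constant Courant algebroid to its pairing and its anchor; under the second, the pair $(\langle\cdot,\cdot\rangle,\partial)$ corresponds to the class of $(V_\bullet,\omega)$ if and only if the identifications carry $B_\omega$ (at every $x\in V_0$)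 to $\langle\cdot,\cdot\rangle$ and $\partial:\hat T_1\to V_0$ to $\partial$. (b) There is a bijection between isomorphism classes of constant Courant algebroids and equivalence classes of constant symplectic 2-groupoids, under which the class of $W_1\times W_0\to W_0$ corresponds to the class of $(V_\bullet,\omega)$ if and only if there are linear isomorphisms $\hat T_1\cong W_1$ and $V_0\cong W_0$ carrying $B_\omega$ to the pairing and $\partial$ to the anchor. -/

import Mathlib

open CategoryTheory Opposite
open scoped Simplicial

universe u

noncomputable section

namespace ConstantCourant

/-! ### Smooth maps and differential 2-forms on finite-dimensional real vector spaces

No norm is chosen on the vector spaces: a map `f : V → W` is smooth if all its components `ξ ∘ f`,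
for `ξ` a linear functional on `W`, are smooth functions of linear coordinates on `V`. -/

section Smooth

variable {V W V' : Type u} [AddCommGroup V] [Module ℝ V] [FiniteDimensional ℝ V]
  [AddCommGroup W] [Module ℝ W] [AddCommGroup V'] [Module ℝ V'] [FiniteDimensional ℝ V']

/-- The linear coordinates on `V` given by a basis. -/
def coords (V : Type u) [AddCommGroup V] [Module ℝ V] [FiniteDimensional ℝ V] :
    V ≃ₗ[ℝ] (Fin (Module.finrank ℝ V) → ℝ) :=
  (Module.finBasis ℝ V).equivFun

/-- A smooth real-valued function on the vector space `V`. -/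
def SmoothFun (f : V → ℝ) : Prop :=
  ContDiff ℝ (⊤ : ℕ∞) fun y => f ((coords V).symm y)

/-- A smooth map between vector spaces. -/
def SmoothMap (f : V → W) : Prop :=
  ∀ ξ : W →ₗ[ℝ] ℝ, SmoothFun fun x => ξ (f x)

theorem SmoothFun.const (c : ℝ) : SmoothFun (fun _ : V => c) := contDiff_const

theorem SmoothFun.add {f g : V → ℝ} (hf : SmoothFun f) (hg : SmoothFun g) :
    SmoothFun fun x => f x + g x := ContDiff.add hf hg

theorem SmoothFun.mul {f g : V → ℝ} (hf : SmoothFun f) (hg : SmoothFun g) :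
    SmoothFun fun x => f x * g x := ContDiff.mul hf hg

theorem SmoothFun.neg {f : V → ℝ} (hf : SmoothFun f) : SmoothFun fun x => -f x :=
  ContDiff.neg hf

theorem SmoothFun.comp_linear {f : V → ℝ} (hf : SmoothFun f) (L : V' →ₗ[ℝ] V) :
    SmoothFun fun x => f (L x) := by
  have h : ContDiff ℝ (⊤ : ℕ∞) (LinearMap.toContinuousLinearMap
      ((coords V).toLinearMap ∘ₗ L ∘ₗ (coords V').symm.toLinearMap)) :=
    ContinuousLinearMap.contDiff _
  have h2 := ContDiff.comp hf h
  refine (congrArg (ContDiff ℝ (⊤ : ℕ∞)) ?_).mp h2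
  funext y
  simp

theorem SmoothFun.lineDifferentiableAt {f : V → ℝ} (hf : SmoothFun f) (x v : V) :
    LineDifferentiableAt ℝ f x v := by
  have h : ContDiff ℝ (⊤ : ℕ∞) fun t : ℝ => coords V x + t • coords V v := by fun_prop
  have h2 := (ContDiff.comp hf h).differentiable (by simp)
  refine (congrArg (fun g => DifferentiableAt ℝ g (0 : ℝ)) ?_).mp (h2 0)
  funext t
  simp

/-- A smooth differential 2-form on the vector space `V`; the tangent space of `V` at every point
is identified with `V`. -/
def IsTwoForm (α : V → LinearMap.BilinForm ℝ V) : Prop :=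
  (∀ x, (α x).IsAlt) ∧ ∀ u v, SmoothFun fun x => α x u v

/-- `dα = 0`, where the exterior derivative is evaluated on constant vector fields. -/
def IsClosedForm (α : V → LinearMap.BilinForm ℝ V) : Prop :=
  ∀ x u v w, lineDeriv ℝ (fun y => α y v w) x u - lineDeriv ℝ (fun y => α y u w) x v
    + lineDeriv ℝ (fun y => α y u v) x w = 0

/-- The pullback of a 2-form along a linear map. -/
def pullback (L : V' →ₗ[ℝ] V) (α : V → LinearMap.BilinForm ℝ V) :
    V' → LinearMap.BilinForm ℝ V' :=
  fun x => (α (L x)).compl₁₂ L L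

end Smooth

/-! ### Simplicial vector spaces and linear 2-groupoids -/

section Simplicial

/-- A simplicial real vector space. -/
abbrev SVect := SimplicialObject (ModuleCat.{u} ℝ)

variable (X : SVect.{u})

/-- The face map `f_i : X_{q+1} → X_q`. -/
def face (q : ℕ) (i : Fin (q + 2)) : X _⦋q + 1⦌ →ₗ[ℝ] X _⦋q⦌ := (X.δ i).hom

/-- The degeneracy map `σ_i : X_q → X_{q+1}`. -/
def degen (q : ℕ) (i : Fin (q + 1)) : X _⦋q⦌ →ₗ[ℝ] X _⦋q + 1⦌ := (X.σ i).hom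

/-- The space of `(q + 1, k)`-horns: families of `q`-simplices `x_i`, `i ≠ k`, such that
`f_i x_j = f_{j-1} x_i` for `i < j`. For `q = 0` there is no condition. In the case `q + 1` below,
the pair of indices `i < j` is written as `i.castSucc < j.succ` with `i ≤ j`. -/
def hornSpace (q : ℕ) (k : Fin (q + 2)) : Submodule ℝ ({i : Fin (q + 2) // i ≠ k} → X _⦋q⦌) :=
  match q, k with
  | 0, _ => ⊤
  | q + 1, k =>
    { carrier := {x | ∀ (i j : Fin (q + 2)), i ≤ j → ∀ (hi : i.castSucc ≠ k) (hj : j.succ ≠ k),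
        face X q i (x ⟨j.succ, hj⟩) = face X q j (x ⟨i.castSucc, hi⟩)}
      add_mem' := by
        intro a b ha hb i j hij hi hj
        simp only [Pi.add_apply, map_add, ha i j hij hi hj, hb i j hij hi hj]
      zero_mem' := by
        intro i j _ _ _
        simp
      smul_mem' := by
        intro c a ha i j hij hi hj
        simp only [Pi.smul_apply, map_smul, ha i j hij hi hj] }

theorem face_face (q : ℕ) {i j : Fin (q + 2)} (h : i ≤ j) (x : X _⦋q + 2⦌) :
    face X q i (face X (q + 1) j.succ x) = face X q j (face X (q + 1) i.castSucc x) := by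
  have := X.δ_comp_δ h
  exact congrArg (fun g => g.hom x) this

theorem hornMap_mem (q : ℕ) (k : Fin (q + 2)) (x : X _⦋q + 1⦌) :
    (fun i : {i : Fin (q + 2) // i ≠ k} => face X q i.1 x) ∈ hornSpace X q k := by
  cases q with
  | zero => exact Submodule.mem_top
  | succ q => exact fun i j hij _ _ => face_face X q hij x

/-- The horn map `λ_{q+1,k} : X_{q+1} → Λ_{q+1,k} X`. -/
def hornMap (q : ℕ) (k : Fin (q + 2)) : X _⦋q + 1⦌ →ₗ[ℝ] hornSpace X q k :=
  LinearMap.codRestrict (hornSpace X q k) (LinearMap.pi fun i => face X q i.1) (hornMap_mem X q k)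

/-! ### The tangent complex

All tangent spaces of `X_q` are identified with `X_q`, so the tangent complex of `X` at any point
of `X_0` is the normalized chain complex of `X`. -/

/-- The sum of the degenerate subspaces of `X_{q+1}`. -/
def degenerate (q : ℕ) : Submodule ℝ (X _⦋q + 1⦌) :=
  ⨆ i : Fin (q + 1), LinearMap.range (degen X q i)

/-- The normalized tangent space in degree `q + 1`. -/
abbrev NormTangent (q : ℕ) := X _⦋q + 1⦌ ⧸ degenerate X q

/-- The alternating sum of the face maps. -/
def boundary (q : ℕ) : X _⦋q + 1⦌ →ₗ[ℝ] X _⦋q⦌ :=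
  ∑ i : Fin (q + 2), (-1 : ℝ) ^ (i : ℕ) • face X q i

theorem face_degen_castSucc (q : ℕ) (i : Fin (q + 1)) (x : X _⦋q⦌) :
    face X q i.castSucc (degen X q i x) = x :=
  congrArg (fun g => g.hom x) (X.δ_comp_σ_self (i := i))

theorem face_degen_succ (q : ℕ) (i : Fin (q + 1)) (x : X _⦋q⦌) :
    face X q i.succ (degen X q i x) = x :=
  congrArg (fun g => g.hom x) (X.δ_comp_σ_succ (i := i))

theorem degen_degen (x : X _⦋0⦌) :
    degen X 1 0 (degen X 0 0 x) = degen X 1 1 (degen X 0 0 x) :=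
  congrArg (fun g => g.hom x) (X.σ_comp_σ (le_refl (0 : Fin 1)))

theorem degenerate_le_ker_boundary : degenerate X 0 ≤ LinearMap.ker (boundary X 0) := by
  refine iSup_le fun i => ?_
  rintro _ ⟨v, rfl⟩
  have h0 := face_degen_castSucc X 0 i v
  have h1 := face_degen_succ X 0 i v
  fin_cases i
  have h : boundary X 0 = face X 0 0 - face X 0 1 := by
    unfold boundary
    rw [Fin.sum_univ_two]
    simp [sub_eq_add_neg]
  rw [LinearMap.mem_ker, h, LinearMap.sub_apply]
  exact sub_eq_zero.mpr (h0.trans h1.symm)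

/-- The boundary map `∂ : T̂_1 → T_0` of the tangent complex. -/
def tangentBoundary : NormTangent X 0 →ₗ[ℝ] X _⦋0⦌ :=
  (degenerate X 0).liftQ (boundary X 0) (degenerate_le_ker_boundary X)

/-! ### Forms on simplicial vector spaces -/

/-- The simplicial coboundary `δα = ∑ (-1)^i f_i^* α`. -/
def coboundary (q : ℕ) (α : X _⦋q⦌ → LinearMap.BilinForm ℝ (X _⦋q⦌)) :
    X _⦋q + 1⦌ → LinearMap.BilinForm ℝ (X _⦋q + 1⦌) :=
  fun x => ∑ i : Fin (q + 2), (-1 : ℝ) ^ (i : ℕ) • pullback (face X q i) α x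

/-- A 2-form is multiplicative if its simplicial coboundary vanishes. -/
def IsMultiplicative (q : ℕ) (α : X _⦋q⦌ → LinearMap.BilinForm ℝ (X _⦋q⦌)) : Prop :=
  coboundary X q α = 0

/-- A 2-form on `X_{q+1}` is normalized if its pullback by every degeneracy map vanishes. -/
def IsNormalized (q : ℕ) (α : X _⦋q + 1⦌ → LinearMap.BilinForm ℝ (X _⦋q + 1⦌)) : Prop :=
  ∀ i : Fin (q + 1), pullback (degen X q i) α = 0

/-- The total degeneracy `σ² : X_0 → X_2`. -/
def unitTwo : X _⦋0⦌ →ₗ[ℝ] X _⦋2⦌ := degen X 1 0 ∘ₗ degen X 0 0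

variable (ω : X _⦋2⦌ → LinearMap.BilinForm ℝ (X _⦋2⦌))

/-- `Ã_ω(v, w) = ω(σ² v, w)` at `x ∈ X_0`. -/
def tildeA (x : X _⦋0⦌) : X _⦋0⦌ →ₗ[ℝ] X _⦋2⦌ →ₗ[ℝ] ℝ :=
  LinearMap.comp (ω (unitTwo X x)) (unitTwo X)

/-- `B̃_ω(θ, η) = ω(σ_1 θ, σ_0 η) + ω(σ_1 η, σ_0 θ)` at `x ∈ X_0`. -/
def tildeB (x : X _⦋0⦌) : X _⦋1⦌ →ₗ[ℝ] X _⦋1⦌ →ₗ[ℝ] ℝ :=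
  (ω (unitTwo X x)).compl₁₂ (degen X 1 1) (degen X 1 0)
    + ((ω (unitTwo X x)).compl₁₂ (degen X 1 1) (degen X 1 0)).flip

theorem normalized_apply {ω : X _⦋2⦌ → LinearMap.BilinForm ℝ (X _⦋2⦌)} (h : IsNormalized X 1 ω)
    (x : X _⦋0⦌) (i : Fin 2) (a b : X _⦋1⦌) :
    ω (unitTwo X x) (degen X 1 i a) (degen X 1 i b) = 0 := by
  have h1 : unitTwo X x = degen X 1 i (degen X 0 0 x) := by
    fin_cases i
    · rfl
    · exact degen_degen X x
  rw [h1]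
  have h2 := congrFun (h i) (degen X 0 0 x)
  exact congrArg (fun B : LinearMap.BilinForm ℝ (X _⦋1⦌) => B a b) h2

theorem tildeA_right (h : IsNormalized X 1 ω) (x : X _⦋0⦌) :
    degenerate X 1 ≤ LinearMap.ker (tildeA X ω x).flip := by
  refine iSup_le fun i => ?_
  rintro _ ⟨w, rfl⟩
  rw [LinearMap.mem_ker]
  ext v
  have h1 : unitTwo X v = degen X 1 i (degen X 0 0 v) := by
    fin_cases i
    · rfl
    · exact degen_degen X v
  change ω (unitTwo X x) (unitTwo X v) (degen X 1 i w) = 0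
  rw [h1]
  exact normalized_apply X h x i _ _

theorem tildeB_left (h : IsNormalized X 1 ω) (x : X _⦋0⦌) :
    degenerate X 0 ≤ LinearMap.ker (tildeB X ω x) := by
  refine iSup_le fun i => ?_
  rintro _ ⟨v, rfl⟩
  rw [LinearMap.mem_ker]
  ext η
  fin_cases i
  change ω (unitTwo X x) (degen X 1 1 (degen X 0 0 v)) (degen X 1 0 η)
    + ω (unitTwo X x) (degen X 1 1 η) (degen X 1 0 (degen X 0 0 v)) = 0
  rw [← degen_degen, normalized_apply X h, degen_degen, normalized_apply X h, add_zero]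

theorem tildeB_flip (x : X _⦋0⦌) : (tildeB X ω x).flip = tildeB X ω x := by
  ext θ η
  exact add_comm _ _

/-- The pairing `A_ω` of `T_0` with `T̂_2` at `x`, for `ω` normalized. -/
def pairingA (h : IsNormalized X 1 ω) (x : X _⦋0⦌) :
    X _⦋0⦌ →ₗ[ℝ] NormTangent X 1 →ₗ[ℝ] ℝ :=
  ((degenerate X 1).liftQ (tildeA X ω x).flip (tildeA_right X ω h x)).flip

/-- The symmetric bilinear form `B_ω` on `T̂_1` at `x`, for `ω` normalized. -/
def pairingB (h : IsNormalized X 1 ω) (x : X _⦋0⦌) :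
    LinearMap.BilinForm ℝ (NormTangent X 0) :=
  (tildeB X ω x).liftQ₂ (degenerate X 0) (degenerate X 0) (tildeB_left X ω h x)
    ((tildeB_left X ω h x).trans_eq (by rw [tildeB_flip]))

/-- Simplicial nondegeneracy: `A_ω` and `B_ω` are nondegenerate at all points of `X_0`. -/
def SimpliciallyNondegenerate (h : IsNormalized X 1 ω) : Prop :=
  ∀ x, (pairingA X ω h x).Nondegenerate ∧ (pairingB X ω h x).Nondegenerate

/-- Equivalence of 2-forms `ω, ω'` on `X_2`: there is a closed, normalized, not necessarily
constant, 2-form `α` on `X_1` with `ω' - ω = δα` and `A_{δα} = B_{δα} = 0`. -/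
def FormEquivalent [FiniteDimensional ℝ (X _⦋1⦌)]
    (ω ω' : X _⦋2⦌ → LinearMap.BilinForm ℝ (X _⦋2⦌)) : Prop :=
  ∃ α : X _⦋1⦌ → LinearMap.BilinForm ℝ (X _⦋1⦌),
    IsTwoForm α ∧ IsClosedForm α ∧ IsNormalized X 0 α ∧
      (∀ x u v, ω' x u v - ω x u v = coboundary X 1 α x u v) ∧
      (∀ x, tildeA X (coboundary X 1 α) x = 0) ∧ ∀ x, tildeB X (coboundary X 1 α) x = 0

end Simplicial

/-! ### Constant symplectic 2-groupoids -/

/-- A linear 2-groupoid: a simplicial object in finite-dimensional real vector spaces such that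
all horn maps are surjective submersions, and diffeomorphisms in degrees above 2. A linear map
between finite-dimensional vector spaces is a surjective submersion iff it is surjective, and a
diffeomorphism iff it is bijective. Faces are automatically surjective and degeneracies
automatically embeddings, by the simplicial identities. -/
structure LinearTwoGroupoid where
  X : SVect.{u}
  finite : ∀ q, FiniteDimensional ℝ (X _⦋q⦌)
  horn_surjective : ∀ q k, Function.Surjective (hornMap X q k)
  horn_bijective : ∀ q k, 2 < q + 1 → Function.Bijective (hornMap X q k)

attribute [instance] LinearTwoGroupoid.finite

/-- A constant symplectic 2-groupoid: a linear 2-groupoid with a closed, multiplicative,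
normalized, simplicially nondegenerate 2-form on `X_2` which is constant. -/
structure ConstantSymplecticTwoGroupoid extends LinearTwoGroupoid.{u} where
  ω : X _⦋2⦌ → LinearMap.BilinForm ℝ (X _⦋2⦌)
  isTwoForm : IsTwoForm ω
  closed : IsClosedForm ω
  multiplicative : IsMultiplicative X 2 ω
  normalized : IsNormalized X 1 ω
  nondegenerate : SimpliciallyNondegenerate X ω normalized
  constant : ∀ x y, ω x = ω y

/-- The linear map in degree `q` of a morphism of simplicial vector spaces. -/
def degreeMap {X Y : SVect.{u}} (φ : X ⟶ Y) (q : ℕ) : X _⦋q⦌ →ₗ[ℝ] Y _⦋q⦌ :=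
  (φ.app (op ⦋q⦌)).hom

section FormEquivalent

variable {X Y : SVect.{u}}

theorem degreeMap_face (φ : X ⟶ Y) (q : ℕ) (i : Fin (q + 2)) (x : X _⦋q + 1⦌) :
    degreeMap φ q (face X q i x) = face Y q i (degreeMap φ (q + 1) x) :=
  congrArg (fun g => g.hom x) (SimplicialObject.δ_naturality φ i)

theorem degreeMap_degen (φ : X ⟶ Y) (q : ℕ) (i : Fin (q + 1)) (x : X _⦋q⦌) :
    degreeMap φ (q + 1) (degen X q i x) = degen Y q i (degreeMap φ q x) :=
  congrArg (fun g => g.hom x) (SimplicialObject.σ_naturality φ i)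

theorem degreeMap_unitTwo (φ : X ⟶ Y) (x : X _⦋0⦌) :
    degreeMap φ 2 (unitTwo X x) = unitTwo Y (degreeMap φ 0 x) :=
  (degreeMap_degen φ 1 0 _).trans (congrArg _ (degreeMap_degen φ 0 0 x))

theorem coboundary_pullback (φ : X ⟶ Y) (α : Y _⦋1⦌ → LinearMap.BilinForm ℝ (Y _⦋1⦌)) :
    coboundary X 1 (pullback (degreeMap φ 1) α) = pullback (degreeMap φ 2) (coboundary Y 1 α) := by
  funext x
  ext u v
  simp [coboundary, pullback, degreeMap_face]

theorem coboundary_add (α β : X _⦋1⦌ → LinearMap.BilinForm ℝ (X _⦋1⦌)) :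
    coboundary X 1 (α + β) = coboundary X 1 α + coboundary X 1 β := by
  funext x
  ext u v
  simp [coboundary, pullback, Finset.sum_add_distrib, mul_add]

theorem coboundary_neg (α : X _⦋1⦌ → LinearMap.BilinForm ℝ (X _⦋1⦌)) :
    coboundary X 1 (-α) = -coboundary X 1 α := by
  funext x
  ext u v
  simp [coboundary, pullback]

theorem FormEquivalent.refl [FiniteDimensional ℝ (X _⦋1⦌)]
    (ω : X _⦋2⦌ → LinearMap.BilinForm ℝ (X _⦋2⦌)) : FormEquivalent X ω ω := by
  have h0 : coboundary X 1 0 = 0 := by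
    funext x
    ext u v
    simp [coboundary, pullback]
  refine ⟨0, ⟨fun x v => rfl, fun u v => SmoothFun.const 0⟩, ?_, ?_, ?_, ?_, ?_⟩
  · intro x u v w
    simp [lineDeriv]
  · intro i
    rfl
  · intro x u v
    rw [h0, sub_self]
    rfl
  · intro x
    rw [h0]
    rfl
  · intro x
    rw [h0]
    ext u v
    simp [tildeB]

theorem FormEquivalent.symm [FiniteDimensional ℝ (X _⦋1⦌)]
    {ω ω' : X _⦋2⦌ → LinearMap.BilinForm ℝ (X _⦋2⦌)} (h : FormEquivalent X ω ω') :
    FormEquivalent X ω' ω := by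
  obtain ⟨α, ⟨h1, h2⟩, h3, h4, h5, h6, h7⟩ := h
  refine ⟨-α, ⟨fun x v => ?_, fun u v => (h2 u v).neg⟩, ?_, ?_, ?_, ?_, ?_⟩
  · simp [h1 x v]
  · intro x u v w
    have := h3 x u v w
    simp only [lineDeriv, Pi.neg_apply, LinearMap.neg_apply, deriv.fun_neg] at this ⊢
    linarith
  · intro i
    have := h4 i
    funext x
    ext u v
    have := congrFun this x
    have := congrArg (fun B : LinearMap.BilinForm ℝ (X _⦋0⦌) => B u v) this
    simpa [pullback] using this
  · intro x u v
    rw [coboundary_neg, ← neg_sub, h5]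
    rfl
  · intro x
    have := h6 x
    rw [coboundary_neg]
    ext u v
    have := congrArg (fun B : X _⦋0⦌ →ₗ[ℝ] X _⦋2⦌ →ₗ[ℝ] ℝ => B u v) this
    simpa [tildeA] using this
  · intro x
    have := h7 x
    rw [coboundary_neg]
    ext u v
    have := congrArg (fun B : X _⦋1⦌ →ₗ[ℝ] X _⦋1⦌ →ₗ[ℝ] ℝ => B u v) this
    simp only [tildeB, LinearMap.add_apply, LinearMap.flip_apply, LinearMap.compl₁₂_apply,
      Pi.neg_apply, LinearMap.neg_apply, LinearMap.zero_apply] at this ⊢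
    linarith

theorem FormEquivalent.trans [FiniteDimensional ℝ (X _⦋1⦌)]
    {ω ω' ω'' : X _⦋2⦌ → LinearMap.BilinForm ℝ (X _⦋2⦌)} (h : FormEquivalent X ω ω')
    (h' : FormEquivalent X ω' ω'') : FormEquivalent X ω ω'' := by
  obtain ⟨α, ⟨h1, h2⟩, h3, h4, h5, h6, h7⟩ := h
  obtain ⟨β, ⟨k1, k2⟩, k3, k4, k5, k6, k7⟩ := h'
  refine ⟨α + β, ⟨fun x v => ?_, fun u v => (h2 u v).add (k2 u v)⟩, ?_, ?_, ?_, ?_, ?_⟩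
  · simp [h1 x v, k1 x v]
  · intro x u v w
    have e : ∀ x u v w, lineDeriv ℝ (fun y => (α + β) y v w) x u
        = lineDeriv ℝ (fun y => α y v w) x u + lineDeriv ℝ (fun y => β y v w) x u :=
      fun x u v w => deriv_fun_add ((h2 v w).lineDifferentiableAt x u)
        ((k2 v w).lineDifferentiableAt x u)
    have := h3 x u v w
    have := k3 x u v w
    rw [e, e, e]
    linarith
  · intro i
    funext x
    ext u v
    have h := congrArg (fun B : LinearMap.BilinForm ℝ (X _⦋0⦌) => B u v) (congrFun (h4 i) x)
    have k := congrArg (fun B : LinearMap.BilinForm ℝ (X _⦋0⦌) => B u v) (congrFun (k4 i) x)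
    simp only [pullback, LinearMap.compl₁₂_apply, Pi.zero_apply, LinearMap.zero_apply,
      Pi.add_apply, LinearMap.add_apply] at h k ⊢
    rw [h, k, add_zero]
  · intro x u v
    rw [coboundary_add]
    exact (sub_add_sub_cancel' _ _ _).symm.trans (congrArg₂ (· + ·) (h5 x u v) (k5 x u v))
  · intro x
    rw [coboundary_add]
    ext u v
    have h := congrArg (fun B : X _⦋0⦌ →ₗ[ℝ] X _⦋2⦌ →ₗ[ℝ] ℝ => B u v) (h6 x)
    have k := congrArg (fun B : X _⦋0⦌ →ₗ[ℝ] X _⦋2⦌ →ₗ[ℝ] ℝ => B u v) (k6 x)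
    simp only [tildeA, LinearMap.comp_apply, Pi.add_apply, LinearMap.add_apply,
      LinearMap.zero_apply] at h k ⊢
    rw [h, k, add_zero]
  · intro x
    rw [coboundary_add]
    ext u v
    have h := congrArg (fun B : X _⦋1⦌ →ₗ[ℝ] X _⦋1⦌ →ₗ[ℝ] ℝ => B u v) (h7 x)
    have k := congrArg (fun B : X _⦋1⦌ →ₗ[ℝ] X _⦋1⦌ →ₗ[ℝ] ℝ => B u v) (k7 x)
    simp only [tildeB, LinearMap.add_apply, LinearMap.flip_apply, LinearMap.compl₁₂_apply,
      Pi.add_apply, LinearMap.zero_apply] at h k ⊢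
    linarith

theorem FormEquivalent.pullback [FiniteDimensional ℝ (X _⦋1⦌)] [FiniteDimensional ℝ (Y _⦋1⦌)]
    (φ : X ⟶ Y) {ω ω' : Y _⦋2⦌ → LinearMap.BilinForm ℝ (Y _⦋2⦌)} (h : FormEquivalent Y ω ω') :
    FormEquivalent X (pullback (degreeMap φ 2) ω) (pullback (degreeMap φ 2) ω') := by
  obtain ⟨α, ⟨h1, h2⟩, h3, h4, h5, h6, h7⟩ := h
  refine ⟨ConstantCourant.pullback (degreeMap φ 1) α,
    ⟨fun x v => h1 _ _, fun u v => (h2 _ _).comp_linear (degreeMap φ 1)⟩, ?_, ?_, ?_, ?_, ?_⟩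
  · intro x u v w
    have := h3 (degreeMap φ 1 x) (degreeMap φ 1 u) (degreeMap φ 1 v) (degreeMap φ 1 w)
    simpa [lineDeriv, ConstantCourant.pullback] using this
  · intro i
    funext x
    ext u v
    have h := congrArg (fun B : LinearMap.BilinForm ℝ (Y _⦋0⦌) =>
      B (degreeMap φ 0 u) (degreeMap φ 0 v)) (congrFun (h4 i) (degreeMap φ 0 x))
    have e := degreeMap_degen φ 0 i
    change α (degreeMap φ (0 + 1) (degen X 0 i x)) (degreeMap φ (0 + 1) (degen X 0 i u))
      (degreeMap φ (0 + 1) (degen X 0 i v)) = 0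
    rw [e, e, e]
    exact h
  · intro x u v
    rw [coboundary_pullback]
    exact h5 _ _ _
  · intro x
    rw [coboundary_pullback]
    ext u v
    have h := congrArg (fun B : Y _⦋0⦌ →ₗ[ℝ] Y _⦋2⦌ →ₗ[ℝ] ℝ =>
      B (degreeMap φ 0 u) (degreeMap φ 2 v)) (h6 (degreeMap φ 0 x))
    simp only [tildeA, LinearMap.comp_apply, ConstantCourant.pullback, LinearMap.compl₁₂_apply,
      degreeMap_unitTwo]
    exact h
  · intro x
    rw [coboundary_pullback]
    ext u v
    have h := congrArg (fun B : Y _⦋1⦌ →ₗ[ℝ] Y _⦋1⦌ →ₗ[ℝ] ℝ =>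
      B (degreeMap φ 1 u) (degreeMap φ 1 v)) (h7 (degreeMap φ 0 x))
    have e := degreeMap_degen φ 1
    simp only [Nat.reduceAdd] at e
    simp only [tildeB, LinearMap.add_apply, LinearMap.flip_apply, ConstantCourant.pullback,
      LinearMap.compl₁₂_apply, degreeMap_unitTwo, e]
    exact h

end FormEquivalent

namespace ConstantSymplecticTwoGroupoid

/-- `φ` is an isomorphism of linear 2-groupoids and `S.ω` is equivalent to `φ^* T.ω`. -/
def IsEquivalence {S T : ConstantSymplecticTwoGroupoid.{u}} (φ : S.X ≅ T.X) : Prop :=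
  FormEquivalent S.X S.ω (pullback (degreeMap φ.hom 2) T.ω)

theorem IsEquivalence.refl (S : ConstantSymplecticTwoGroupoid.{u}) :
    IsEquivalence (S := S) (T := S) (Iso.refl S.X) :=
  FormEquivalent.refl S.ω

theorem IsEquivalence.symm {S T : ConstantSymplecticTwoGroupoid.{u}} {φ : S.X ≅ T.X}
    (h : IsEquivalence φ) : IsEquivalence (S := T) (T := S) φ.symm := by
  have h' := (FormEquivalent.pullback φ.inv h).symm
  have e : ∀ x, degreeMap φ.hom 2 (degreeMap φ.inv 2 x) = x := fun x =>
    congrArg (fun g => (g.app (op ⦋2⦌)).hom x) φ.inv_hom_id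
  refine (congrArg (fun η => FormEquivalent T.X η _) ?_).mp h'
  funext x
  ext u v
  simp [pullback, e]

theorem IsEquivalence.trans {S T U : ConstantSymplecticTwoGroupoid.{u}} {φ : S.X ≅ T.X}
    {ψ : T.X ≅ U.X} (h : IsEquivalence φ) (k : IsEquivalence ψ) :
    IsEquivalence (S := S) (T := U) (φ ≪≫ ψ) :=
  FormEquivalent.trans h (FormEquivalent.pullback φ.hom k)

/-- Equivalence of constant symplectic 2-groupoids, up to isomorphism of the underlying linear
2-groupoids. -/
instance setoid : Setoid ConstantSymplecticTwoGroupoid.{u} where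
  r S T := ∃ φ : S.X ≅ T.X, IsEquivalence φ
  iseqv := ⟨fun S => ⟨_, IsEquivalence.refl S⟩, fun ⟨_, h⟩ => ⟨_, h.symm⟩,
    fun ⟨_, h⟩ ⟨_, k⟩ => ⟨_, h.trans k⟩⟩

end ConstantSymplecticTwoGroupoid

/-- A constant symplectic 2-groupoid whose tangent complex is identified, in degrees 1 and 0, with
the given vector spaces `W₁` and `W₀`. -/
structure MarkedSymplecticTwoGroupoid (W₁ W₀ : Type u) [AddCommGroup W₁] [Module ℝ W₁]
    [AddCommGroup W₀] [Module ℝ W₀] extends ConstantSymplecticTwoGroupoid.{u} where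
  mark₁ : NormTangent X 0 ≃ₗ[ℝ] W₁
  mark₀ : X _⦋0⦌ ≃ₗ[ℝ] W₀

/-- Equivalence of constant symplectic 2-groupoids by isomorphisms that induce the identity on
`W₁` and `W₀`. -/
instance MarkedSymplecticTwoGroupoid.setoid (W₁ W₀ : Type u) [AddCommGroup W₁] [Module ℝ W₁]
    [AddCommGroup W₀] [Module ℝ W₀] : Setoid (MarkedSymplecticTwoGroupoid W₁ W₀) where
  r S T := ∃ φ : S.X ≅ T.X, ConstantSymplecticTwoGroupoid.IsEquivalence φ ∧
    (∀ θ : S.X _⦋1⦌, T.mark₁ (Submodule.Quotient.mk (degreeMap φ.hom 1 θ))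
      = S.mark₁ (Submodule.Quotient.mk θ)) ∧
    ∀ v : S.X _⦋0⦌, T.mark₀ (degreeMap φ.hom 0 v) = S.mark₀ v
  iseqv :=
    { refl := fun S => ⟨_, ConstantSymplecticTwoGroupoid.IsEquivalence.refl _,
        fun _ => rfl, fun _ => rfl⟩
      symm := by
        rintro S T ⟨φ, h, h1, h0⟩
        refine ⟨_, h.symm, fun θ => ?_, fun v => ?_⟩
        · have e : degreeMap φ.hom 1 (degreeMap φ.inv 1 θ) = θ :=
            congrArg (fun g => (g.app (op ⦋1⦌)).hom θ) φ.inv_hom_id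
          have := h1 (degreeMap φ.inv 1 θ)
          rw [e] at this
          exact this.symm
        · have e : degreeMap φ.hom 0 (degreeMap φ.inv 0 v) = v :=
            congrArg (fun g => (g.app (op ⦋0⦌)).hom v) φ.inv_hom_id
          have := h0 (degreeMap φ.inv 0 v)
          rw [e] at this
          exact this.symm
      trans := by
        rintro S T U ⟨φ, h, h1, h0⟩ ⟨ψ, k, k1, k0⟩
        exact ⟨_, h.trans k, fun θ => (k1 _).trans (h1 θ), fun v => (k0 _).trans (h0 v)⟩ }

/-! ### Constant Courant algebroids -/

section Courant

variable (W₁ W₀ : Type u) [AddCommGroup W₁] [Module ℝ W₁] [FiniteDimensional ℝ W₁]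
  [AddCommGroup W₀] [Module ℝ W₀] [FiniteDimensional ℝ W₀]

/-- The smooth sections of the trivial vector bundle `W₁ × W₀ → W₀`. -/
def Sections : Submodule ℝ (W₀ → W₁) where
  carrier := {e | SmoothMap e}
  add_mem' := fun ha hb ξ => by
    simpa using (ha ξ).add (hb ξ)
  zero_mem' := fun ξ => by
    simpa using SmoothFun.const 0
  smul_mem' := fun c a ha ξ => by
    simpa using (SmoothFun.const c).mul (ha ξ)

variable {W₁ W₀}

/-- The product of a smooth function and a section. -/
def Sections.mulFun (f : W₀ → ℝ) (hf : SmoothFun f) (e : Sections W₁ W₀) : Sections W₁ W₀ :=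
  ⟨fun x => f x • e.1 x, fun ξ => by simpa using hf.mul (e.2 ξ)⟩

/-- A vector, viewed as a constant section. -/
def Sections.const (w : W₁) : Sections W₁ W₀ :=
  ⟨fun _ => w, fun ξ => SmoothFun.const (ξ w)⟩

variable (W₁ W₀)

/-- A Courant algebroid structure on the vector bundle `W₁ × W₀ → W₀`. For a section `e` and a
function `f`, the function `ρ(e)(f)` is `x ↦ lineDeriv ℝ f x (anchor x (e x))`. -/
@[ext]
structure CourantAlgebroid where
  pairing : W₀ → LinearMap.BilinForm ℝ W₁
  anchor : W₀ → W₁ →ₗ[ℝ] W₀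
  bracket : Sections W₁ W₀ →ₗ[ℝ] Sections W₁ W₀ →ₗ[ℝ] Sections W₁ W₀
  pairing_smooth : ∀ w w', SmoothFun fun x => pairing x w w'
  pairing_symm : ∀ x, (pairing x).IsSymm
  pairing_nondegenerate : ∀ x, (pairing x).Nondegenerate
  anchor_smooth : ∀ w, SmoothMap fun x => anchor x w
  /-- `[e₁, f e₂] = ρ(e₁)(f) e₂ + f [e₁, e₂]` -/
  leibniz : ∀ (e₁ e₂ : Sections W₁ W₀) (f : W₀ → ℝ) (hf : SmoothFun f) (x : W₀),
    (bracket e₁ (Sections.mulFun f hf e₂)).1 x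
      = lineDeriv ℝ f x (anchor x (e₁.1 x)) • e₂.1 x + f x • (bracket e₁ e₂).1 x
  /-- `ρ(e₁)⟨e₂, e₃⟩ = ⟨[e₁, e₂], e₃⟩ + ⟨e₂, [e₁, e₃]⟩` -/
  invariance : ∀ (e₁ e₂ e₃ : Sections W₁ W₀) (x : W₀),
    lineDeriv ℝ (fun y => pairing y (e₂.1 y) (e₃.1 y)) x (anchor x (e₁.1 x))
      = pairing x ((bracket e₁ e₂).1 x) (e₃.1 x) + pairing x (e₂.1 x) ((bracket e₁ e₃).1 x)
  /-- `[[e₁, e₂], e₃] = [e₁, [e₂, e₃]] - [e₂, [e₁, e₃]]` -/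
  jacobi : ∀ e₁ e₂ e₃ : Sections W₁ W₀,
    bracket (bracket e₁ e₂) e₃ = bracket e₁ (bracket e₂ e₃) - bracket e₂ (bracket e₁ e₃)
  /-- `[e₁, e₂] + [e₂, e₁] = 𝒟⟨e₁, e₂⟩`, where `⟨𝒟f, e⟩ = ρ(e)(f)` for all sections `e` -/
  skew : ∀ (e₁ e₂ e : Sections W₁ W₀) (x : W₀),
    pairing x ((bracket e₁ e₂ + bracket e₂ e₁).1 x) (e.1 x)
      = lineDeriv ℝ (fun y => pairing y (e₁.1 y) (e₂.1 y)) x (anchor x (e.1 x))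

/-- A constant Courant algebroid structure on `W₁ × W₀ → W₀`. -/
@[ext]
structure ConstantCourantAlgebroid extends CourantAlgebroid W₁ W₀ where
  pairing_constant : ∀ x y, pairing x = pairing y
  anchor_constant : ∀ x y, anchor x = anchor y
  bracket_constant : ∀ w w' : W₁, bracket (Sections.const w) (Sections.const w') = 0

/-- The linear algebra data: a nondegenerate symmetric bilinear form on `W₁` and a linear map
`∂ : W₁ → W₀` with `∂ ∘ ∂^* = 0`, where `∂^* : W₀^* → W₁^* ≅ W₁`. -/
@[ext]
structure IsotropicData where
  pairing : LinearMap.BilinForm ℝ W₁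
  symm : pairing.IsSymm
  nondegenerate : pairing.Nondegenerate
  del : W₁ →ₗ[ℝ] W₀
  isotropic : del ∘ₗ (pairing.toDual nondegenerate).symm.toLinearMap ∘ₗ del.dualMap = 0

end Courant

/-- A constant Courant algebroid together with its underlying vector spaces. -/
structure BundledConstantCourant where
  W₁ : Type u
  W₀ : Type u
  [addCommGroup₁ : AddCommGroup W₁]
  [module₁ : Module ℝ W₁]
  [finite₁ : FiniteDimensional ℝ W₁]
  [addCommGroup₀ : AddCommGroup W₀]
  [module₀ : Module ℝ W₀]
  [finite₀ : FiniteDimensional ℝ W₀]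
  E : ConstantCourantAlgebroid W₁ W₀

attribute [instance] BundledConstantCourant.addCommGroup₁ BundledConstantCourant.module₁
  BundledConstantCourant.finite₁ BundledConstantCourant.addCommGroup₀
  BundledConstantCourant.module₀ BundledConstantCourant.finite₀

namespace BundledConstantCourant

/-- The linear isomorphism of vector bundles `φ₁ × φ₀` preserves pairing, anchor and bracket. -/
structure IsIsomorphism {C D : BundledConstantCourant.{u}} (φ₁ : C.W₁ ≃ₗ[ℝ] D.W₁)
    (φ₀ : C.W₀ ≃ₗ[ℝ] D.W₀) : Prop where
  pairing : ∀ x w w', D.E.pairing (φ₀ x) (φ₁ w) (φ₁ w') = C.E.pairing x w w'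
  anchor : ∀ x w, D.E.anchor (φ₀ x) (φ₁ w) = φ₀ (C.E.anchor x w)
  bracket : ∀ (e₁ e₂ : Sections C.W₁ C.W₀) (e₁' e₂' : Sections D.W₁ D.W₀),
    (∀ x, e₁'.1 (φ₀ x) = φ₁ (e₁.1 x)) → (∀ x, e₂'.1 (φ₀ x) = φ₁ (e₂.1 x)) →
      ∀ x, (D.E.bracket e₁' e₂').1 (φ₀ x) = φ₁ ((C.E.bracket e₁ e₂).1 x)

/-- Isomorphism of constant Courant algebroids. -/
instance setoid : Setoid BundledConstantCourant.{u} where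
  r C D := ∃ (φ₁ : C.W₁ ≃ₗ[ℝ] D.W₁) (φ₀ : C.W₀ ≃ₗ[ℝ] D.W₀), IsIsomorphism φ₁ φ₀
  iseqv :=
    { refl := fun C => ⟨LinearEquiv.refl ℝ _, LinearEquiv.refl ℝ _, fun _ _ _ => rfl,
        fun _ _ => rfl, fun e₁ e₂ e₁' e₂' h₁ h₂ x => by
          have h1 : e₁' = e₁ := Subtype.ext (funext h₁)
          have h2 : e₂' = e₂ := Subtype.ext (funext h₂)
          rw [h1, h2]
          rfl⟩
      symm := by
        rintro C D ⟨φ₁, φ₀, h⟩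
        refine ⟨φ₁.symm, φ₀.symm, fun x w w' => ?_, fun x w => ?_, fun e₁ e₂ e₁' e₂' h₁ h₂ x => ?_⟩
        · simpa using (h.pairing (φ₀.symm x) (φ₁.symm w) (φ₁.symm w')).symm
        · rw [LinearEquiv.eq_symm_apply, ← h.anchor]
          simp
        · rw [LinearEquiv.eq_symm_apply, ← h.bracket e₁' e₂' e₁ e₂]
          · simp
          · intro y
            have := h₁ (φ₀ y)
            rw [φ₀.symm_apply_apply, LinearEquiv.eq_symm_apply] at this
            exact this.symm
          · intro y
            have := h₂ (φ₀ y)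
            rw [φ₀.symm_apply_apply, LinearEquiv.eq_symm_apply] at this
            exact this.symm
      trans := by
        rintro C D F ⟨φ₁, φ₀, h⟩ ⟨ψ₁, ψ₀, k⟩
        refine ⟨φ₁.trans ψ₁, φ₀.trans ψ₀, fun x w w' => ?_, fun x w => ?_,
          fun e₁ e₂ e₁' e₂' h₁ h₂ x => ?_⟩
        · exact (k.pairing _ _ _).trans (h.pairing _ _ _)
        · exact (k.anchor _ _).trans (congrArg ψ₀ (h.anchor _ _))
        · let push : Sections C.W₁ C.W₀ → Sections D.W₁ D.W₀ := fun e =>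
            ⟨fun y => φ₁ (e.1 (φ₀.symm y)), fun ξ =>
              (e.2 (ξ ∘ₗ φ₁.toLinearMap)).comp_linear φ₀.symm.toLinearMap⟩
          have hp : ∀ e x, (push e).1 (φ₀ x) = φ₁ (e.1 x) := fun e x => by simp [push]
          have hk := k.bracket (push e₁) (push e₂) e₁' e₂'
            (fun y => by simpa [push] using h₁ (φ₀.symm y))
            (fun y => by simpa [push] using h₂ (φ₀.symm y)) (φ₀ x)
          exact hk.trans (congrArg ψ₁ (h.bracket e₁ e₂ _ _ (hp e₁) (hp e₂) x)) }

end BundledConstantCourant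

/-- The constant Courant algebroid `C` and the constant symplectic 2-groupoid `S` correspond to
each other: the tangent complex of `S` in degrees 1 and 0, with the form `B_ω`, is isomorphic to
the anchor of `C` with its pairing. -/
def Corresponds (C : BundledConstantCourant.{u}) (S : ConstantSymplecticTwoGroupoid.{u}) : Prop :=
  ∃ (φ₁ : NormTangent S.X 0 ≃ₗ[ℝ] C.W₁) (φ₀ : S.X _⦋0⦌ ≃ₗ[ℝ] C.W₀),
    (∀ x θ η, C.E.pairing (φ₀ x) (φ₁ θ) (φ₁ η) = pairingB S.X S.ω S.normalized x θ η) ∧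
    ∀ x θ, C.E.anchor x (φ₁ θ) = φ₀ (tangentBoundary S.X θ)

end ConstantCourant

end

/-!
The invariance of the pairing and the axiom on `[e₁, e₂] + [e₂, e₁]` express the bracket of a
constant Courant algebroid through its pairing and its anchor `∂`, because constant sections have
zero bracket. The resulting bracket `[e₁, e₂] = De₂(∂e₁) - De₁(∂e₂) + ∂^*⟨De₁(·), e₂⟩` satisfies
the Jacobi identity exactly when `∂ ∘ ∂^* = 0`.

For a constant symplectic 2-groupoid, `A_ω` identifies `T̂₂` with the dual of `V₀`, and
multiplicativity gives `A_ω(∂θ, w) = B_ω(θ, ∂w)`. Hence the normalized complex of `V` is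
`W₀^* → W₁ → W₀` with differentials `∂^*` and `∂`, and `V` is recovered from `(B_ω, ∂)` by the
Dold-Kan correspondence. Conversely, the simplicial vector space of this complex carries the
symplectic form given by an antisymmetrized cup product. A multiplicative normalized constant form
with `A_ω = B_ω = 0` is the coboundary of `-η`, where `η(θ, θ') = ω(σ₁θ, σ₀θ')`, so `A_ω` and `B_ω`
determine `ω` up to equivalence.
-/

noncomputable section

namespace ConstantCourant

/-! ### The Kan condition -/

section Kan

variable {X : SVect.{u}} {q : ℕ}

theorem face_castSucc_degen_succ {i : Fin (q + 2)} {j : Fin (q + 1)} (h : i ≤ j.castSucc)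
    (x : X _⦋q + 1⦌) :
    face X (q + 1) i.castSucc (degen X (q + 1) j.succ x) = degen X q j (face X q i x) :=
  congrArg (fun g => g.hom x) (X.δ_comp_σ_of_le h)

theorem face_succ_degen_castSucc {i : Fin (q + 2)} {j : Fin (q + 1)} (h : j.castSucc < i)
    (x : X _⦋q + 1⦌) :
    face X (q + 1) i.succ (degen X (q + 1) j.castSucc x) = degen X q j (face X q i x) :=
  congrArg (fun g => g.hom x) (X.δ_comp_σ_of_gt h)

theorem face_degen_of_lt {i r : Fin (q + 2)} (h : i < r) {x : X _⦋q + 1⦌} (hx : face X q i x = 0) :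
    face X (q + 1) i.castSucc (degen X (q + 1) r x) = 0 := by
  obtain ⟨j, rfl⟩ := Fin.exists_succ_eq.mpr (Fin.ne_zero_of_lt h)
  rw [face_castSucc_degen_succ (Fin.le_castSucc_iff.mpr h), hx, map_zero]

theorem face_degen_of_gt {i r : Fin (q + 2)} (h : r < i) {x : X _⦋q + 1⦌} (hx : face X q i x = 0) :
    face X (q + 1) i.succ (degen X (q + 1) r x) = 0 := by
  obtain ⟨j, rfl⟩ := Fin.exists_castSucc_eq.mpr (Fin.ne_last_of_lt h)
  rw [face_succ_degen_castSucc h, hx, map_zero]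

variable {k : Fin (q + 3)} (z : hornSpace X (q + 1) k)

theorem face_horn_of_lt {i : Fin (q + 2)} (s : {i // i ≠ k}) (h : i.castSucc < s.1)
    (hi : i.castSucc ≠ k) (hz : z.1 ⟨i.castSucc, hi⟩ = 0) : face X q i (z.1 s) = 0 := by
  obtain ⟨s, hs⟩ := s
  obtain ⟨j, rfl⟩ := Fin.exists_succ_eq.mpr (Fin.ne_zero_of_lt h)
  rw [z.2 i j (Fin.castSucc_lt_succ_iff.mp h) hi hs, hz, map_zero]

theorem face_horn_of_gt {i : Fin (q + 2)} (s : {i // i ≠ k}) (h : s.1 < i.succ)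
    (hi : i.succ ≠ k) (hz : z.1 ⟨i.succ, hi⟩ = 0) : face X q i (z.1 s) = 0 := by
  obtain ⟨s, hs⟩ := s
  obtain ⟨j, rfl⟩ := Fin.exists_castSucc_eq.mpr (Fin.ne_last_of_lt h)
  rw [← z.2 j i (Fin.castSucc_lt_succ_iff.mp h) hs hi, hz, map_zero]

theorem horn_sub_degen_eq_zero_of_le {r : Fin (q + 2)} (hr : r.castSucc ≠ k)
    (hz : ∀ i : {i // i ≠ k}, i.1 < r.castSucc → z.1 i = 0) (i : {i // i ≠ k})
    (hi : i.1 ≤ r.castSucc) :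
    (z - hornMap X (q + 1) k (degen X (q + 1) r (z.1 ⟨r.castSucc, hr⟩))).1 i = 0 := by
  change z.1 i - face X (q + 1) i.1 (degen X (q + 1) r (z.1 ⟨r.castSucc, hr⟩)) = 0
  obtain ⟨i, hik⟩ := i
  rcases hi.eq_or_lt with rfl | hir
  · rw [face_degen_castSucc, sub_self]
  · obtain ⟨j, rfl⟩ := Fin.exists_castSucc_eq.mpr (Fin.ne_last_of_lt hir)
    have hzj := hz ⟨j.castSucc, hik⟩ hir
    rw [hzj, face_degen_of_lt (Fin.castSucc_lt_castSucc_iff.mp hir)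
      (face_horn_of_lt z _ hir hik hzj), sub_zero]

theorem horn_sub_degen_eq_zero_of_lt_or_ge {r : Fin (q + 2)} (hr : k < r.succ)
    (hz : ∀ i : {i // i ≠ k}, i.1 < k ∨ r.succ < i.1 → z.1 i = 0) (i : {i // i ≠ k})
    (hi : i.1 < k ∨ r.succ ≤ i.1) :
    (z - hornMap X (q + 1) k (degen X (q + 1) r (z.1 ⟨r.succ, hr.ne'⟩))).1 i = 0 := by
  change z.1 i - face X (q + 1) i.1 (degen X (q + 1) r (z.1 ⟨r.succ, hr.ne'⟩)) = 0
  obtain ⟨i, hik⟩ := i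
  rcases hi with hlt | hge
  · obtain ⟨j, rfl⟩ := Fin.exists_castSucc_eq.mpr (Fin.ne_last_of_lt hlt)
    have hjr : j < r := Fin.castSucc_lt_castSucc_iff.mp
      (hlt.trans_le (Fin.le_castSucc_iff.mpr hr))
    have hzj := hz ⟨j.castSucc, hik⟩ (Or.inl hlt)
    rw [hzj, face_degen_of_lt hjr (face_horn_of_lt z _ (hlt.trans hr) hik hzj), sub_zero]
  rcases hge.eq_or_lt with rfl | hgt
  · rw [face_degen_succ, sub_self]
  · obtain ⟨j, rfl⟩ := Fin.exists_succ_eq.mpr (Fin.ne_zero_of_lt hgt)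
    have hzj := hz ⟨j.succ, hik⟩ (Or.inr hgt)
    rw [hzj, face_degen_of_gt (Fin.succ_lt_succ_iff.mp hgt) (face_horn_of_gt z _ hgt hik hzj),
      sub_zero]

variable (X) in
/-- The horns filled by sums of degenerate simplices. -/
def degenerateHorns (q : ℕ) (k : Fin (q + 2)) : Submodule ℝ (hornSpace X q k) :=
  (degenerate X q).map (hornMap X q k)

theorem degen_mem_degenerate (i : Fin (q + 1)) (x : X _⦋q⦌) : degen X q i x ∈ degenerate X q :=
  Submodule.mem_iSup_of_mem i ⟨x, rfl⟩

variable {z} in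
theorem mem_degenerateHorns_of_sub {r : Fin (q + 2)} {x : X _⦋q + 1⦌}
    (h : z - hornMap X (q + 1) k (degen X (q + 1) r x) ∈ degenerateHorns X (q + 1) k) :
    z ∈ degenerateHorns X (q + 1) k :=
  (Submodule.sub_mem_iff_left _ (Submodule.mem_map_of_mem (degen_mem_degenerate r x))).mp h

theorem mem_degenerateHorns_of_lt_or_gt (m : ℕ) :
    ∀ z : hornSpace X (q + 1) k, (∀ i : {i // i ≠ k}, i.1 < k ∨ m < i.1.1 → z.1 i = 0) →
      z ∈ degenerateHorns X (q + 1) k := by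
  induction m with
  | zero =>
    intro z hz
    have hz0 : z = 0 := Subtype.ext <| funext fun i => hz i <| by
      have := Fin.val_ne_of_ne i.2
      rw [Fin.lt_def]
      omega
    exact hz0 ▸ Submodule.zero_mem _
  | succ m ih =>
    intro z hz
    by_cases hm : k.1 < m + 1 ∧ m < q + 2
    · let r : Fin (q + 2) := ⟨m, hm.2⟩
      exact mem_degenerateHorns_of_sub <| ih _ <|
        horn_sub_degen_eq_zero_of_lt_or_ge z (r := r) hm.1 hz
    · refine ih z fun i hi => hz i ?_
      have := Fin.val_ne_of_ne i.2
      rw [Fin.lt_def] at hi ⊢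
      omega

theorem mem_degenerateHorns_of_lt (m : ℕ) (hm : m ≤ k.1) :
    ∀ z : hornSpace X (q + 1) k, (∀ i : {i // i ≠ k}, i.1.1 < m → z.1 i = 0) →
      z ∈ degenerateHorns X (q + 1) k := by
  induction hm using Nat.decreasingInduction with
  | self =>
    exact fun z hz => mem_degenerateHorns_of_lt_or_gt (q + 2) z fun i hi =>
      hz i (hi.resolve_right (by omega))
  | of_succ m hm ih =>
    intro z hz
    let r : Fin (q + 2) := ⟨m, by omega⟩
    have hr : r.castSucc ≠ k := ne_of_lt hm
    exact mem_degenerateHorns_of_sub <| ih _ fun i hi =>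
      horn_sub_degen_eq_zero_of_le z hr hz i (Nat.lt_succ_iff.mp hi)

variable (X) in
theorem degenerateHorns_eq_top (q : ℕ) (k : Fin (q + 2)) : degenerateHorns X q k = ⊤ := by
  refine (Submodule.eq_top_iff').mpr fun z => ?_
  cases q with
  | zero =>
    have other_index : ∀ k : Fin 2, ∃ i₀ : {i // i ≠ k}, ∀ i : {i // i ≠ k}, i = i₀ := by decide
    obtain ⟨i₀, eq_i₀⟩ := other_index k
    refine ⟨_, degen_mem_degenerate 0 (z.1 i₀), Subtype.ext (funext fun i => ?_)⟩
    obtain rfl := eq_i₀ i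
    change face X 0 i.1 (degen X 0 0 (z.1 i)) = z.1 i
    generalize i.1 = j
    fin_cases j
    · exact face_degen_castSucc X 0 0 _
    · exact face_degen_succ X 0 0 _
  | succ q =>
    exact mem_degenerateHorns_of_lt 0 (Nat.zero_le _) z fun i hi => absurd hi i.1.1.not_lt_zero

variable (X) in
theorem hornMap_surjective (q : ℕ) (k : Fin (q + 2)) : Function.Surjective (hornMap X q k) := by
  intro z
  obtain ⟨y, -, hy⟩ := (degenerateHorns_eq_top X q k).ge (Submodule.mem_top (x := z))
  exact ⟨y, hy⟩

theorem exists_sub_mem_degenerate (k : Fin (q + 2)) (x : X _⦋q + 1⦌) :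
    ∃ y ∈ degenerate X q, ∀ i ≠ k, face X q i (x - y) = 0 := by
  obtain ⟨y, hy, hxy⟩ :=
    (degenerateHorns_eq_top X q k).ge (Submodule.mem_top (x := hornMap X q k x))
  refine ⟨y, hy, fun i hi => ?_⟩
  rw [map_sub, sub_eq_zero]
  exact (congrFun (congrArg Subtype.val hxy) ⟨i, hi⟩).symm

theorem degenerate_eq_top_of_hornMap_injective {k : Fin (q + 2)}
    (h : Function.Injective (hornMap X q k)) : degenerate X q = ⊤ := by
  refine (Submodule.eq_top_iff').mpr fun x => ?_
  obtain ⟨y, hy, hxy⟩ := exists_sub_mem_degenerate k x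
  have : x - y = 0 := (map_eq_zero_iff _ h).mp (Subtype.ext (funext fun i => hxy i.1 i.2))
  exact sub_eq_zero.mp this ▸ hy

/-- The sum of the images of the first `r` degeneracies. -/
def degenerateBelow (X : SVect.{u}) (q r : ℕ) : Submodule ℝ (X _⦋q + 1⦌) :=
  ⨆ i : {i : Fin (q + 1) // i.1 < r}, LinearMap.range (degen X q i.1)

theorem degenerateBelow_succ_le (r : Fin (q + 1)) :
    degenerateBelow X q (r + 1) ≤ degenerateBelow X q r ⊔ LinearMap.range (degen X q r) := by
  refine iSup_le fun ⟨i, hi⟩ => ?_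
  rcases Nat.lt_succ_iff_lt_or_eq.mp hi with hir | hir
  · exact le_sup_of_le_left (le_iSup_of_le ⟨i, hir⟩ le_rfl)
  · obtain rfl : i = r := Fin.ext hir
    exact le_sup_right

theorem degen_face_mem_degenerateBelow {r : Fin (q + 1)} {y : X _⦋q + 1⦌}
    (hy : y ∈ degenerateBelow X q r) :
    degen X q r (face X q r.succ y) ∈ degenerateBelow X q r := by
  suffices degenerateBelow X q r ≤
      (degenerateBelow X q r).comap (degen X q r ∘ₗ face X q r.succ) from this hy
  refine iSup_le fun ⟨i, hir⟩ => ?_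
  rintro _ ⟨b, rfl⟩
  cases q with
  | zero => exact absurd hir (by omega)
  | succ q =>
    obtain ⟨i, rfl⟩ := Fin.exists_castSucc_eq.mpr (Fin.ne_last_of_lt hir)
    obtain ⟨l, rfl⟩ := Fin.exists_succ_eq.mpr (Fin.ne_zero_of_lt hir)
    have face_degen : face X (q + 1) l.succ.succ (degen X (q + 1) i.castSucc b)
        = degen X q i (face X q l.succ b) := face_succ_degen_castSucc hir b
    have degen_degen : degen X (q + 1) l.succ (degen X q i (face X q l.succ b))
        = degen X (q + 1) i.castSucc (degen X q l (face X q l.succ b)) :=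
      (congrArg (fun g => g.hom (face X q l.succ b))
        (X.σ_comp_σ (Fin.castSucc_lt_succ_iff.mp hir))).symm
    refine Submodule.mem_iSup_of_mem ⟨i.castSucc, hir⟩ ⟨degen X q l (face X q l.succ b), ?_⟩
    rw [LinearMap.comp_apply, face_degen, degen_degen]

theorem mem_degenerateBelow_of_face_eq_zero {r : Fin (q + 1)} {x : X _⦋q + 1⦌}
    (hx : x ∈ degenerateBelow X q (r + 1)) (h : face X q r.succ x = 0) :
    x ∈ degenerateBelow X q r := by
  obtain ⟨y, hy, _, ⟨a, rfl⟩, rfl⟩ := Submodule.mem_sup.mp (degenerateBelow_succ_le r hx)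
  rw [map_add, face_degen_succ] at h
  rw [eq_neg_of_add_eq_zero_right h, map_neg]
  exact Submodule.add_mem _ hy (Submodule.neg_mem _ (degen_face_mem_degenerateBelow hy))

theorem eq_zero_of_mem_degenerate {x : X _⦋q + 1⦌} (hx : x ∈ degenerate X q)
    (h : ∀ i, face X q i x = 0) : x = 0 := by
  suffices key : ∀ r ≤ q + 1, x ∈ degenerateBelow X q r from
    (Submodule.mem_bot ℝ).mp ((iSup_le fun i => absurd i.2 (Nat.not_lt_zero _) :
      degenerateBelow X q 0 ≤ ⊥) (key 0 (Nat.zero_le _)))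
  intro r hr
  induction hr using Nat.decreasingInduction with
  | self => exact (iSup_le fun i => le_iSup_of_le ⟨i, i.2⟩ le_rfl :
      degenerate X q ≤ degenerateBelow X q (q + 1)) hx
  | of_succ r hr ih => exact mem_degenerateBelow_of_face_eq_zero (r := ⟨r, hr⟩) ih (h _)

end Kan

/-! ### The Dold-Kan correspondence -/

section DoldKan

variable (K : ChainComplex (ModuleCat.{u} ℝ) ℕ)

/-- The chain maps from the normalized chain complex of the simplex `Δ` to `K`: families of
functions on the simplices of `Δ` that vanish on degenerate simplices and commute with the
differentials. -/
def normalizedCochains (Δ : SimplexCategory) : Submodule ℝ (∀ m, (⦋m⦌ ⟶ Δ) → K.X m) where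
  carrier := {c |
    (∀ m (i : Fin (m + 1)) (f : ⦋m⦌ ⟶ Δ), c (m + 1) (SimplexCategory.σ i ≫ f) = 0) ∧
    ∀ m (f : ⦋m + 1⦌ ⟶ Δ), (K.d (m + 1) m).hom (c (m + 1) f)
      = ∑ i : Fin (m + 2), (-1 : ℝ) ^ (i : ℕ) • c m (SimplexCategory.δ i ≫ f)}
  zero_mem' := by simp
  add_mem' := by
    rintro a b ⟨ha, ha'⟩ ⟨hb, hb'⟩
    refine ⟨fun m i f => ?_, fun m f => ?_⟩
    · simp [ha, hb]
    · simp only [Pi.add_apply, map_add, ha', hb', smul_add, Finset.sum_add_distrib]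
  smul_mem' := by
    rintro r a ⟨ha, ha'⟩
    refine ⟨fun m i f => ?_, fun m f => ?_⟩
    · simp [ha]
    · simp only [Pi.smul_apply, map_smul, ha', Finset.smul_sum, smul_comm r]

/-- Restriction of normalized cochains along a simplicial operator. -/
def cochainMap {Δ Δ' : SimplexCategory} (g : Δ ⟶ Δ') :
    normalizedCochains K Δ' →ₗ[ℝ] normalizedCochains K Δ :=
  (LinearMap.pi fun m => LinearMap.funLeft ℝ (K.X m) (· ≫ g) ∘ₗ LinearMap.proj m).restrict
    fun _ hc => ⟨fun m i f => hc.1 m i (f ≫ g), fun m f => hc.2 m (f ≫ g)⟩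

/-- The simplicial vector space corresponding to the chain complex `K`. -/
def doldKan : SVect.{u} where
  obj Δ := ModuleCat.of ℝ (normalizedCochains K Δ.unop)
  map g := ModuleCat.ofHom (cochainMap K g.unop)
  map_id _ := ModuleCat.hom_ext <| LinearMap.ext fun c => Subtype.ext <|
    funext₂ fun m f => congrArg (c.1 m) (Category.comp_id f)
  map_comp g h := ModuleCat.hom_ext <| LinearMap.ext fun c => Subtype.ext <|
    funext₂ fun m f => congrArg (c.1 m) (Category.assoc f h.unop g.unop).symm

variable {K} {m n : ℕ}

/-- The value of a simplex of `doldKan K`, regarded as a cochain, on `f : ⦋m⦌ ⟶ ⦋n⦌`. -/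
def value (f : ⦋m⦌ ⟶ ⦋n⦌) : doldKan K _⦋n⦌ →ₗ[ℝ] K.X m :=
  LinearMap.proj f ∘ₗ LinearMap.proj m ∘ₗ (normalizedCochains K ⦋n⦌).subtype

/-- The component of a simplex of `doldKan K` in the chain complex `K`. -/
abbrev topValue (n : ℕ) : doldKan K _⦋n⦌ →ₗ[ℝ] K.X n := value (𝟙 ⦋n⦌)

theorem doldKan_ext {x y : doldKan K _⦋n⦌}
    (h : ∀ (m : ℕ) (f : ⦋m⦌ ⟶ ⦋n⦌), value f x = value f y) : x = y :=
  Subtype.ext (funext₂ h)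

theorem value_face (i : Fin (n + 2)) (f : ⦋m⦌ ⟶ ⦋n⦌) (x : doldKan K _⦋n + 1⦌) :
    value f (face (doldKan K) n i x) = value (f ≫ SimplexCategory.δ i) x := rfl

theorem value_degen (i : Fin (n + 1)) (f : ⦋m⦌ ⟶ ⦋n + 1⦌) (x : doldKan K _⦋n⦌) :
    value f (degen (doldKan K) n i x) = value (f ≫ SimplexCategory.σ i) x := rfl

theorem value_σ_comp (i : Fin (m + 1)) (f : ⦋m⦌ ⟶ ⦋n⦌) (x : doldKan K _⦋n⦌) :
    value (SimplexCategory.σ i ≫ f) x = 0 := x.2.1 m i f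

theorem d_value (f : ⦋m + 1⦌ ⟶ ⦋n⦌) (x : doldKan K _⦋n⦌) :
    (K.d (m + 1) m).hom (value f x)
      = ∑ i : Fin (m + 2), (-1 : ℝ) ^ (i : ℕ) • value (SimplexCategory.δ i ≫ f) x := x.2.2 m f

theorem value_eq_zero_of_lt (h : n < m) (f : ⦋m⦌ ⟶ ⦋n⦌) (x : doldKan K _⦋n⦌) :
    value f x = 0 := by
  obtain ⟨m, rfl⟩ := Nat.exists_eq_succ_of_ne_zero (Nat.ne_zero_of_lt h)
  have not_injective : ¬Function.Injective f.toOrderHom := fun hf => by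
    have := Fintype.card_le_of_injective _ hf
    simp only [SimplexCategory.len_mk, Fintype.card_fin] at this
    omega
  obtain ⟨i, g, rfl⟩ := SimplexCategory.eq_σ_comp_of_not_injective f not_injective
  exact value_σ_comp i g x

theorem value_self_eq_zero {x : doldKan K _⦋n⦌} (h : topValue n x = 0) (f : ⦋n⦌ ⟶ ⦋n⦌) :
    value f x = 0 := by
  cases n with
  | zero => rwa [Subsingleton.elim f (𝟙 _)]
  | succ n =>
    by_cases hf : Function.Injective f.toOrderHom
    · have : Mono f := SimplexCategory.mono_iff_injective.mpr hf
      rwa [SimplexCategory.eq_id_of_mono f]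
    · obtain ⟨i, g, rfl⟩ := SimplexCategory.eq_σ_comp_of_not_injective f hf
      exact value_σ_comp i g x

theorem eq_zero_of_topValue_zero {x : doldKan K _⦋0⦌} (h : topValue 0 x = 0) : x = 0 := by
  refine doldKan_ext fun m f => ?_
  rw [map_zero]
  rcases m.eq_zero_or_pos with rfl | hm
  · exact value_self_eq_zero h f
  · exact value_eq_zero_of_lt hm f x

theorem eq_zero_of_topValue_of_face {x : doldKan K _⦋n + 1⦌} (h : topValue (n + 1) x = 0)
    (hx : ∀ i, face (doldKan K) n i x = 0) : x = 0 := by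
  refine doldKan_ext fun m f => ?_
  rw [map_zero]
  rcases lt_trichotomy m (n + 1) with hm | rfl | hm
  · have not_surjective : ¬Function.Surjective f.toOrderHom := fun hf => by
      have := Fintype.card_le_of_surjective _ hf
      simp only [SimplexCategory.len_mk, Fintype.card_fin] at this
      omega
    obtain ⟨i, g, rfl⟩ := SimplexCategory.eq_comp_δ_of_not_surjective f not_surjective
    rw [← value_face, hx, map_zero]
  · exact value_self_eq_zero h f
  · exact value_eq_zero_of_lt hm f x

theorem d_topValue (x : doldKan K _⦋n + 1⦌) :
    (K.d (n + 1) n).hom (topValue (n + 1) x) = topValue n (boundary (doldKan K) n x) := by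
  rw [d_value, boundary, LinearMap.sum_apply, map_sum]
  refine Finset.sum_congr rfl fun i _ => ?_
  rw [LinearMap.smul_apply, map_smul, value_face, Category.comp_id, Category.id_comp]

theorem face_face_eq_zero_of_horn {X : SVect.{u}} {q : ℕ} {k : Fin (q + 3)} {x : X _⦋q + 2⦌}
    (h : ∀ i ≠ k, face X (q + 1) i x = 0) (j : Fin (q + 2)) :
    face X q j (face X (q + 1) k x) = 0 := by
  rcases lt_or_ge j.castSucc k with hjk | hkj
  · obtain ⟨k, rfl⟩ := Fin.exists_succ_eq.mpr (Fin.ne_zero_of_lt hjk)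
    rw [face_face X q (Fin.castSucc_lt_succ_iff.mp hjk), h _ hjk.ne, map_zero]
  · obtain ⟨k, rfl⟩ := Fin.exists_castSucc_eq.mpr
      (Fin.ne_last_of_lt (Fin.le_castSucc_iff.mp hkj))
    rw [← face_face X q (Fin.castSucc_le_castSucc_iff.mp hkj),
      h _ (ne_of_gt (Fin.le_castSucc_iff.mp hkj)), map_zero]

theorem eq_zero_of_topValue_of_horn {k : Fin (n + 2)} {x : doldKan K _⦋n + 1⦌}
    (h : topValue (n + 1) x = 0) (hx : ∀ i ≠ k, face (doldKan K) n i x = 0) : x = 0 := by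
  have topValue_face : topValue n (face (doldKan K) n k x) = 0 := by
    have hd := d_topValue x
    rw [h, map_zero, boundary, LinearMap.sum_apply, Finset.sum_eq_single k
      (fun i _ hi => by rw [LinearMap.smul_apply, hx i hi, smul_zero]) (by simp),
      LinearMap.smul_apply, map_smul, eq_comm, smul_eq_zero] at hd
    exact hd.resolve_left (pow_ne_zero _ (by norm_num))
  have face_k : face (doldKan K) n k x = 0 := by
    cases n with
    | zero => exact eq_zero_of_topValue_zero topValue_face
    | succ n => exact eq_zero_of_topValue_of_face topValue_face (face_face_eq_zero_of_horn hx)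
  refine eq_zero_of_topValue_of_face h fun i => ?_
  by_cases hik : i = k
  · rw [hik, face_k]
  · exact hx i hik

theorem degenerate_doldKan : degenerate (doldKan K) n = LinearMap.ker (topValue (n + 1)) := by
  have degenerate_le : degenerate (doldKan K) n ≤ LinearMap.ker (topValue (n + 1)) := by
    refine iSup_le fun i => ?_
    rintro _ ⟨x, rfl⟩
    rw [LinearMap.mem_ker, value_degen, Category.id_comp, ← Category.comp_id (SimplexCategory.σ i),
      value_σ_comp]
  refine degenerate_le.antisymm fun x hx => ?_
  obtain ⟨y, hy, hxy⟩ := exists_sub_mem_degenerate 0 x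
  have hxy0 : x - y = 0 := eq_zero_of_topValue_of_horn
    (by rw [map_sub, LinearMap.mem_ker.mp hx, degenerate_le hy, sub_zero]) hxy
  exact sub_eq_zero.mp hxy0 ▸ hy

theorem not_mono_σ_comp {Δ : SimplexCategory} (i : Fin (m + 1)) (f : ⦋m⦌ ⟶ Δ) :
    ¬Mono (SimplexCategory.σ i ≫ f) := fun _ => by
  have : Mono (SimplexCategory.σ i) := mono_of_mono _ f
  have := SimplexCategory.len_le_of_mono (SimplexCategory.σ i)
  simp at this

theorem not_mono_δ_σ_comp {Δ : SimplexCategory} {i : Fin (m + 2)} {j : Fin (m + 1)}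
    (hi : i ≠ j.castSucc) (hi' : i ≠ j.succ) (g : ⦋m⦌ ⟶ Δ) :
    ¬Mono (SimplexCategory.δ i ≫ SimplexCategory.σ j ≫ g) := by
  obtain ⟨a, ha⟩ := Fin.exists_succAbove_eq hi.symm
  obtain ⟨b, hb⟩ := Fin.exists_succAbove_eq hi'.symm
  rw [SimplexCategory.mono_iff_injective]
  intro injective
  have hab : a = b := injective <| congrArg g.toOrderHom <|
    show j.predAbove (i.succAbove a) = j.predAbove (i.succAbove b) by
      rw [ha, hb, Fin.predAbove_castSucc_self, Fin.predAbove_succ_self]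
  exact Fin.castSucc_lt_succ.ne (ha.symm.trans (hab ▸ hb))

theorem sum_δ_σ_comp_eq_zero {V : Type*} [AddCommGroup V] [Module ℝ V] {Δ : SimplexCategory}
    {c : (⦋m⦌ ⟶ Δ) → V} (hc : ∀ f : ⦋m⦌ ⟶ Δ, ¬Mono f → c f = 0) (j : Fin (m + 1))
    (g : ⦋m⦌ ⟶ Δ) :
    ∑ i : Fin (m + 2),
      (-1 : ℝ) ^ (i : ℕ) • c (SimplexCategory.δ i ≫ SimplexCategory.σ j ≫ g) = 0 := by
  rw [Fintype.sum_eq_add j.castSucc j.succ (Fin.castSucc_lt_succ).ne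
    (fun i hi => by rw [hc _ (not_mono_δ_σ_comp hi.1 hi.2 g), smul_zero]), ← Category.assoc,
    ← Category.assoc, SimplexCategory.δ_comp_σ_self, SimplexCategory.δ_comp_σ_succ]
  simp [pow_succ]

open Classical in
/-- The normalized cochain on `⦋n⦌` with value `w` on the nondegenerate `n`-simplex: on
`(n - 1)`-simplices it is supported on the face opposite to `0`, where its value is `d w`. -/
def fillingCochain (w : K.X n) (m : ℕ) (f : ⦋m⦌ ⟶ ⦋n⦌) : K.X m :=
  Pi.single (M := fun m => (⦋m⦌ ⟶ ⦋n⦌) → K.X m) n (fun f => if Mono f then w else 0) m f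
    + if Mono f ∧ ∀ a, f.toOrderHom a ≠ 0 then (K.d n m).hom w else 0

theorem fillingCochain_of_not_mono (w : K.X n) {f : ⦋m⦌ ⟶ ⦋n⦌} (hf : ¬Mono f) :
    fillingCochain w m f = 0 := by
  rw [fillingCochain, if_neg fun h => hf h.1, add_zero]
  rcases eq_or_ne m n with rfl | hm
  · rw [Pi.single_eq_same, if_neg hf]
  · rw [Pi.single_eq_of_ne hm, Pi.zero_apply]

theorem fillingCochain_id (w : K.X n) : fillingCochain w n (𝟙 _) = w := by
  simp [fillingCochain, (inferInstance : Mono (𝟙 ⦋n⦌))]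

open Classical in
theorem fillingCochain_of_ne (w : K.X n) (hm : m ≠ n) (f : ⦋m⦌ ⟶ ⦋n⦌) :
    fillingCochain w m f
      = if Mono f ∧ ∀ a, f.toOrderHom a ≠ 0 then (K.d n m).hom w else 0 := by
  rw [fillingCochain, Pi.single_eq_of_ne hm, Pi.zero_apply, zero_add]

theorem fillingCochain_δ (w : K.X (n + 1)) (i : Fin (n + 2)) :
    fillingCochain w n (SimplexCategory.δ i) = if i = 0 then (K.d (n + 1) n).hom w else 0 := by
  classical
  rw [fillingCochain_of_ne w n.lt_succ_self.ne]
  refine if_congr ⟨fun h => ?_, ?_⟩ rfl rfl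
  · by_contra hi
    obtain ⟨a, ha⟩ := Fin.exists_succAbove_eq (Ne.symm hi)
    exact h.2 a ha
  · rintro rfl
    exact ⟨inferInstance, Fin.succ_ne_zero⟩

theorem d_fillingCochain (w : K.X n) (f : ⦋m + 1⦌ ⟶ ⦋n⦌) [Mono f] :
    (K.d (m + 1) m).hom (fillingCochain w (m + 1) f)
      = ∑ i : Fin (m + 2),
        (-1 : ℝ) ^ (i : ℕ) • fillingCochain w m (SimplexCategory.δ i ≫ f) := by
  rcases (SimplexCategory.len_le_of_mono f).lt_or_eq with hm | rfl
  · have hd : (K.d (m + 1) m).hom ((K.d n (m + 1)).hom w) = 0 :=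
      congrArg (fun g => g.hom w) (K.d_comp_d n (m + 1) m)
    have hs (i : Fin (m + 2)) : fillingCochain w m (SimplexCategory.δ i ≫ f) = 0 := by
      rw [fillingCochain_of_ne w (m.lt_succ_self.trans hm).ne, K.shape n m hm.ne]
      exact ite_self _
    simp only [fillingCochain_of_ne w hm.ne, apply_ite, hd, hs, map_zero, ite_self, smul_zero,
      Finset.sum_const_zero]
  · rw [SimplexCategory.eq_id_of_mono f, fillingCochain_id]
    simp [fillingCochain_δ]

theorem fillingCochain_mem (w : K.X n) : fillingCochain w ∈ normalizedCochains K ⦋n⦌ := by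
  refine ⟨fun m i f => fillingCochain_of_not_mono w (not_mono_σ_comp i f), fun m f => ?_⟩
  by_cases hf : Mono f
  · exact d_fillingCochain w f
  · rw [fillingCochain_of_not_mono w hf, map_zero]
    rw [SimplexCategory.mono_iff_injective] at hf
    obtain ⟨j, g, rfl⟩ := SimplexCategory.eq_σ_comp_of_not_injective f hf
    exact (sum_δ_σ_comp_eq_zero (fun _ => fillingCochain_of_not_mono w) j g).symm

theorem topValue_surjective (n : ℕ) : Function.Surjective (topValue (K := K) n) :=
  fun w => ⟨⟨fillingCochain w, fillingCochain_mem w⟩, fillingCochain_id w⟩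

theorem hornMap_doldKan_injective [Subsingleton (K.X (n + 1))] (k : Fin (n + 2)) :
    Function.Injective (hornMap (doldKan K) n k) :=
  (injective_iff_map_eq_zero _).mpr fun _ hx =>
    eq_zero_of_topValue_of_horn (Subsingleton.elim _ _) fun i hi =>
      congrFun (congrArg Subtype.val hx) ⟨i, hi⟩

instance [∀ m, FiniteDimensional ℝ (K.X m)] : FiniteDimensional ℝ (doldKan K _⦋n⦌) := by
  let restrict : doldKan K _⦋n⦌ →ₗ[ℝ] ∀ m : Fin (n + 1), (⦋m⦌ ⟶ ⦋n⦌) → K.X m :=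
    LinearMap.pi fun _ => LinearMap.pi value
  refine FiniteDimensional.of_injective restrict <| (injective_iff_map_eq_zero _).mpr fun x hx =>
    doldKan_ext fun m f => ?_
  rw [map_zero]
  by_cases hm : m < n + 1
  · exact congrFun (congrFun hx ⟨m, hm⟩) f
  · exact value_eq_zero_of_lt (by omega) f x

end DoldKan

section Comparison

variable {X : SVect.{u}} {K : ChainComplex (ModuleCat.{u} ℝ) ℕ}

/-- A chain map from the normalized chain complex of `X` to `K`. -/
structure NormalizedChainMap (X : SVect.{u}) (K : ChainComplex (ModuleCat.{u} ℝ) ℕ) where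
  app : ∀ n, X _⦋n⦌ →ₗ[ℝ] K.X n
  app_degen : ∀ n i x, app (n + 1) (degen X n i x) = 0
  d_app : ∀ n x, (K.d (n + 1) n).hom (app (n + 1) x) = app n (boundary X n x)

namespace NormalizedChainMap

variable (a : NormalizedChainMap X K) {n : ℕ}

/-- The simplicial map adjoint to a chain map out of the normalized chain complex of `X`. -/
def toDoldKan : X ⟶ doldKan K where
  app Δ := ModuleCat.ofHom <|
    (LinearMap.pi fun m => LinearMap.pi fun f => a.app m ∘ₗ (X.map f.op).hom).codRestrict
      (normalizedCochains K Δ.unop) fun x => by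
        refine ⟨fun m i f => ?_, fun m f => ?_⟩
        · simp only [LinearMap.pi_apply, LinearMap.comp_apply, op_comp, X.map_comp]
          exact a.app_degen m i _
        · simp only [LinearMap.pi_apply, LinearMap.comp_apply, op_comp, X.map_comp, a.d_app,
            boundary, LinearMap.sum_apply, LinearMap.smul_apply, map_sum, map_smul]
          rfl
  naturality Δ Δ' g := ModuleCat.hom_ext <| LinearMap.ext fun x => Subtype.ext <|
    funext₂ fun m f => congrArg (fun h => a.app m (h.hom x)) (X.map_comp g f.op).symm

theorem topValue_toDoldKan (x : X _⦋n⦌) : topValue n (degreeMap a.toDoldKan n x) = a.app n x :=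
  congrArg (fun h => a.app n (h.hom x)) (X.map_id _)

theorem toDoldKan_injective_succ (ker_le : LinearMap.ker (a.app (n + 1)) ≤ degenerate X n)
    (injective : Function.Injective (degreeMap a.toDoldKan n)) :
    Function.Injective (degreeMap a.toDoldKan (n + 1)) := by
  refine (injective_iff_map_eq_zero _).mpr fun x hx => ?_
  refine eq_zero_of_mem_degenerate (ker_le ?_) fun i => injective ?_
  · rw [LinearMap.mem_ker, ← topValue_toDoldKan, hx, map_zero]
  · rw [degreeMap_face, hx, map_zero, map_zero]

theorem toDoldKan_surjective_succ (surjective_app : Function.Surjective (a.app (n + 1)))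
    (surjective : Function.Surjective (degreeMap a.toDoldKan n)) :
    Function.Surjective (degreeMap a.toDoldKan (n + 1)) := by
  have degenerate_le : degenerate (doldKan K) n
      ≤ LinearMap.range (degreeMap a.toDoldKan (n + 1)) := by
    refine iSup_le fun i => ?_
    rintro _ ⟨y, rfl⟩
    obtain ⟨x, rfl⟩ := surjective y
    exact ⟨degen X n i x, degreeMap_degen _ n i x⟩
  intro y
  obtain ⟨x, hx⟩ := surjective_app (topValue (n + 1) y)
  obtain ⟨z, hz⟩ := degenerate_le (x := y - degreeMap a.toDoldKan (n + 1) x) <| by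
    rw [degenerate_doldKan, LinearMap.mem_ker, map_sub, topValue_toDoldKan, hx, sub_self]
  exact ⟨z + x, by rw [map_add, hz, sub_add_cancel]⟩

theorem isIso_toDoldKan (bijective_zero : Function.Bijective (a.app 0))
    (surjective_succ : ∀ n, Function.Surjective (a.app (n + 1)))
    (ker_le : ∀ n, LinearMap.ker (a.app (n + 1)) ≤ degenerate X n) : IsIso a.toDoldKan := by
  have bijective (n : ℕ) : Function.Bijective (degreeMap a.toDoldKan n) := by
    induction n with
    | zero =>
      have topValue_bijective : Function.Bijective (topValue (K := K) 0) :=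
        ⟨(injective_iff_map_eq_zero _).mpr fun _ => eq_zero_of_topValue_zero,
          topValue_surjective 0⟩
      refine (Function.Bijective.of_comp_iff' topValue_bijective _).mp ?_
      exact (funext a.topValue_toDoldKan : _ ∘ _ = a.app 0) ▸ bijective_zero
    | succ n ih =>
      exact ⟨a.toDoldKan_injective_succ (ker_le n) ih.1,
        a.toDoldKan_surjective_succ (surjective_succ n) ih.2⟩
  have (Δ : SimplexCategoryᵒᵖ) : IsIso (a.toDoldKan.app Δ) :=
    (ConcreteCategory.isIso_iff_bijective _).mpr (bijective Δ.unop.len)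
  exact NatIso.isIso_of_isIso_app _

end NormalizedChainMap

end Comparison

/-! ### Constant multiplicative 2-forms -/

section Form

variable {V : Type u} [AddCommGroup V] [Module ℝ V]

theorem isTwoForm_const [FiniteDimensional ℝ V] {ω : LinearMap.BilinForm ℝ V} (h : ω.IsAlt) :
    IsTwoForm fun _ : V => ω :=
  ⟨fun _ => h, fun _ _ => SmoothFun.const _⟩

theorem isClosedForm_const (ω : LinearMap.BilinForm ℝ V) : IsClosedForm fun _ : V => ω := by
  intro x u v w
  simp [lineDeriv]

end Form

section AlternatingSums

variable {X : SVect.{u}}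

theorem boundary_zero_apply (θ : X _⦋1⦌) : boundary X 0 θ = face X 0 0 θ - face X 0 1 θ := by
  simp [boundary, Fin.sum_univ_two, sub_eq_add_neg]

theorem boundary_one_apply (w : X _⦋2⦌) :
    boundary X 1 w = face X 1 0 w - face X 1 1 w + face X 1 2 w := by
  simp [boundary, Fin.sum_univ_three, sub_eq_add_neg]

theorem boundary_two_apply (y : X _⦋3⦌) :
    boundary X 2 y = face X 2 0 y - face X 2 1 y + face X 2 2 y - face X 2 3 y := by
  simp [boundary, Fin.sum_univ_four, sub_eq_add_neg, pow_succ]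

theorem boundary_boundary (w : X _⦋2⦌) : boundary X 0 (boundary X 1 w) = 0 := by
  have face_zero_one : face X 0 0 (face X 1 1 w) = face X 0 0 (face X 1 0 w) :=
    face_face X 0 (i := 0) (j := 0) le_rfl w
  have face_zero_two : face X 0 0 (face X 1 2 w) = face X 0 1 (face X 1 0 w) :=
    face_face X 0 (i := 0) (j := 1) (Fin.zero_le _) w
  have face_one_two : face X 0 1 (face X 1 2 w) = face X 0 1 (face X 1 1 w) :=
    face_face X 0 (i := 1) (j := 1) le_rfl w
  simp only [boundary_zero_apply, boundary_one_apply, map_add, map_sub, face_zero_one,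
    face_zero_two, face_one_two]
  abel

theorem coboundary_one_apply (α : X _⦋1⦌ → LinearMap.BilinForm ℝ (X _⦋1⦌)) (y u v : X _⦋2⦌) :
    coboundary X 1 α y u v
      = α (face X 1 0 y) (face X 1 0 u) (face X 1 0 v)
        - α (face X 1 1 y) (face X 1 1 u) (face X 1 1 v)
        + α (face X 1 2 y) (face X 1 2 u) (face X 1 2 v) := by
  simp [coboundary, pullback, Fin.sum_univ_three, sub_eq_add_neg]

theorem coboundary_two_apply (ω : X _⦋2⦌ → LinearMap.BilinForm ℝ (X _⦋2⦌)) (y u v : X _⦋3⦌) :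
    coboundary X 2 ω y u v
      = ω (face X 2 0 y) (face X 2 0 u) (face X 2 0 v)
        - ω (face X 2 1 y) (face X 2 1 u) (face X 2 1 v)
        + ω (face X 2 2 y) (face X 2 2 u) (face X 2 2 v)
        - ω (face X 2 3 y) (face X 2 3 u) (face X 2 3 v) := by
  simp [coboundary, pullback, Fin.sum_univ_four, sub_eq_add_neg, pow_succ]

end AlternatingSums

/-- An alternating form on `X_2` which, as a constant 2-form, is multiplicative and normalized. -/
structure IsNormalizedCocycle (X : SVect.{u}) (ω : LinearMap.BilinForm ℝ (X _⦋2⦌)) : Prop where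
  alt : ω.IsAlt
  cocycle : ∀ u v : X _⦋3⦌,
    ω (face X 2 0 u) (face X 2 0 v) - ω (face X 2 1 u) (face X 2 1 v)
      + ω (face X 2 2 u) (face X 2 2 v) - ω (face X 2 3 u) (face X 2 3 v) = 0
  normalized : ∀ (i : Fin 2) (a b : X _⦋1⦌), ω (degen X 1 i a) (degen X 1 i b) = 0

section FaceDegen

variable {X : SVect.{u}}

theorem faces_degen_zero (x : X _⦋2⦌) :
    face X 2 0 (degen X 2 0 x) = x ∧ face X 2 1 (degen X 2 0 x) = x ∧
    face X 2 2 (degen X 2 0 x) = degen X 1 0 (face X 1 1 x) ∧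
    face X 2 3 (degen X 2 0 x) = degen X 1 0 (face X 1 2 x) :=
  ⟨face_degen_castSucc X 2 0 x, face_degen_succ X 2 0 x,
    face_succ_degen_castSucc (i := 1) (j := 0) (by decide) x,
    face_succ_degen_castSucc (i := 2) (j := 0) (by decide) x⟩

theorem faces_degen_one (x : X _⦋2⦌) :
    face X 2 0 (degen X 2 1 x) = degen X 1 0 (face X 1 0 x) ∧ face X 2 1 (degen X 2 1 x) = x ∧
    face X 2 2 (degen X 2 1 x) = x ∧ face X 2 3 (degen X 2 1 x) = degen X 1 1 (face X 1 2 x) :=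
  ⟨face_castSucc_degen_succ (i := 0) (j := 0) (by decide) x, face_degen_castSucc X 2 1 x,
    face_degen_succ X 2 1 x, face_succ_degen_castSucc (i := 2) (j := 1) (by decide) x⟩

theorem faces_degen_two (x : X _⦋2⦌) :
    face X 2 0 (degen X 2 2 x) = degen X 1 1 (face X 1 0 x) ∧
    face X 2 1 (degen X 2 2 x) = degen X 1 1 (face X 1 1 x) ∧
    face X 2 2 (degen X 2 2 x) = x ∧ face X 2 3 (degen X 2 2 x) = x :=
  ⟨face_castSucc_degen_succ (i := 0) (j := 1) (by decide) x,
    face_castSucc_degen_succ (i := 1) (j := 1) (by decide) x,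
    face_degen_castSucc X 2 2 x, face_degen_succ X 2 2 x⟩

theorem degen_degen_eq_unitTwo (i : Fin 2) (v : X _⦋0⦌) :
    degen X 1 i (degen X 0 0 v) = unitTwo X v := by
  fin_cases i
  · rfl
  · exact (degen_degen X v).symm

theorem face_unitTwo (i : Fin 3) (v : X _⦋0⦌) : face X 1 i (unitTwo X v) = degen X 0 0 v := by
  fin_cases i
  · exact face_degen_castSucc X 1 0 _
  · exact face_degen_succ X 1 0 _
  · exact (face_succ_degen_castSucc (i := 1) (j := 0) (by decide) _).trans
      (congrArg _ (face_degen_succ X 0 0 v))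

end FaceDegen

namespace IsNormalizedCocycle

variable {X Y : SVect.{u}} {ω ω' : LinearMap.BilinForm ℝ (X _⦋2⦌)}

theorem sub (h : IsNormalizedCocycle X ω) (h' : IsNormalizedCocycle X ω') :
    IsNormalizedCocycle X (ω - ω') where
  alt x := by rw [LinearMap.sub_apply, LinearMap.sub_apply, h.alt x, h'.alt x, sub_zero]
  cocycle u v := by
    have := h.cocycle u v
    have := h'.cocycle u v
    simp only [LinearMap.sub_apply]
    linarith
  normalized i a b := by
    rw [LinearMap.sub_apply, LinearMap.sub_apply, h.normalized, h'.normalized, sub_zero]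

theorem pullback (φ : X ⟶ Y) {ω : LinearMap.BilinForm ℝ (Y _⦋2⦌)} (h : IsNormalizedCocycle Y ω) :
    IsNormalizedCocycle X (ω.compl₁₂ (degreeMap φ 2) (degreeMap φ 2)) where
  alt x := h.alt _
  cocycle u v := by
    simp only [LinearMap.compl₁₂_apply, degreeMap_face]
    exact h.cocycle _ _
  normalized i a b := by
    rw [LinearMap.compl₁₂_apply, degreeMap_degen φ 1 i a, degreeMap_degen φ 1 i b]
    exact h.normalized i _ _

variable (h : IsNormalizedCocycle X ω)

include h

theorem isMultiplicative : IsMultiplicative X 2 fun _ => ω :=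
  funext fun _ => LinearMap.ext₂ fun u v => (coboundary_two_apply _ _ u v).trans (h.cocycle u v)

theorem isNormalized : IsNormalized X 1 fun _ => ω :=
  fun i => funext fun _ => LinearMap.ext₂ (h.normalized i)

theorem skew (x y : X _⦋2⦌) : ω x y = -ω y x := (h.alt.neg_eq y x).symm

theorem cocycle_zero_one (x y : X _⦋2⦌) :
    ω x (degen X 1 0 (face X 1 0 y)) - ω x y + ω (degen X 1 0 (face X 1 1 x)) y
      - ω (degen X 1 0 (face X 1 2 x)) (degen X 1 1 (face X 1 2 y)) = 0 := by
  have cocycle := h.cocycle (degen X 2 0 x) (degen X 2 1 y)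
  obtain ⟨x₀, x₁, x₂, x₃⟩ := faces_degen_zero x
  obtain ⟨y₀, y₁, y₂, y₃⟩ := faces_degen_one y
  rwa [x₀, x₁, x₂, x₃, y₀, y₁, y₂, y₃] at cocycle

theorem cocycle_zero_two (x y : X _⦋2⦌) :
    ω x (degen X 1 1 (face X 1 0 y)) - ω x (degen X 1 1 (face X 1 1 y))
      + ω (degen X 1 0 (face X 1 1 x)) y - ω (degen X 1 0 (face X 1 2 x)) y = 0 := by
  have cocycle := h.cocycle (degen X 2 0 x) (degen X 2 2 y)
  obtain ⟨x₀, x₁, x₂, x₃⟩ := faces_degen_zero x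
  obtain ⟨y₀, y₁, y₂, y₃⟩ := faces_degen_two y
  rwa [x₀, x₁, x₂, x₃, y₀, y₁, y₂, y₃] at cocycle

theorem cocycle_one_two (x y : X _⦋2⦌) :
    ω (degen X 1 0 (face X 1 0 x)) (degen X 1 1 (face X 1 0 y))
      - ω x (degen X 1 1 (face X 1 1 y)) + ω x y - ω (degen X 1 1 (face X 1 2 x)) y = 0 := by
  have cocycle := h.cocycle (degen X 2 1 x) (degen X 2 2 y)
  obtain ⟨x₀, x₁, x₂, x₃⟩ := faces_degen_one x
  obtain ⟨y₀, y₁, y₂, y₃⟩ := faces_degen_two y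
  rwa [x₀, x₁, x₂, x₃, y₀, y₁, y₂, y₃] at cocycle

theorem apply_degen_one (x : X _⦋2⦌) (θ : X _⦋1⦌) :
    ω x (degen X 1 1 θ) = ω x (unitTwo X (face X 0 0 θ))
      + ω (degen X 1 0 (face X 1 1 x)) (degen X 1 1 θ)
      - ω (degen X 1 0 (face X 1 2 x)) (degen X 1 1 θ) := by
  have face_zero : face X 1 0 (degen X 1 1 θ) = degen X 0 0 (face X 0 0 θ) :=
    face_castSucc_degen_succ (i := 0) (j := 0) (by decide) θ
  have face_two : face X 1 2 (degen X 1 1 θ) = θ := face_degen_succ X 1 1 θ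
  have cocycle := h.cocycle_zero_one x (degen X 1 1 θ)
  rw [face_zero, face_two, degen_degen_eq_unitTwo] at cocycle
  linarith

theorem apply_degen_zero (x : X _⦋2⦌) (θ : X _⦋1⦌) :
    ω x (degen X 1 0 θ) = ω x (degen X 1 1 θ)
      - ω (degen X 1 0 (face X 1 0 x)) (degen X 1 1 θ)
      + ω (degen X 1 1 (face X 1 2 x)) (degen X 1 0 θ) := by
  have face_zero : face X 1 0 (degen X 1 0 θ) = θ := face_degen_castSucc X 1 0 θ
  have face_one : face X 1 1 (degen X 1 0 θ) = θ := face_degen_succ X 1 0 θ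
  have cocycle := h.cocycle_one_two x (degen X 1 0 θ)
  rw [face_zero, face_one] at cocycle
  linarith

theorem degen_zero_apply (θ : X _⦋1⦌) (y : X _⦋2⦌) :
    ω (degen X 1 0 θ) y = ω (unitTwo X (face X 0 1 θ)) y
      + ω (degen X 1 0 θ) (degen X 1 1 (face X 1 1 y))
      - ω (degen X 1 0 θ) (degen X 1 1 (face X 1 0 y)) := by
  have face_one : face X 1 1 (degen X 1 0 θ) = θ := face_degen_succ X 1 0 θ
  have face_two : face X 1 2 (degen X 1 0 θ) = degen X 0 0 (face X 0 1 θ) :=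
    face_succ_degen_castSucc (i := 1) (j := 0) (by decide) θ
  have cocycle := h.cocycle_zero_two (degen X 1 0 θ) y
  rw [face_one, face_two, degen_degen_eq_unitTwo] at cocycle
  linarith

theorem tildeA_boundary (θ : X _⦋1⦌) (w : X _⦋2⦌) :
    tildeA X (fun _ => ω) 0 (boundary X 0 θ) w = tildeB X (fun _ => ω) 0 θ (boundary X 1 w) := by
  change ω (unitTwo X _) w
    = ω (degen X 1 1 θ) (degen X 1 0 _) + ω (degen X 1 1 _) (degen X 1 0 θ)
  have apply_one := h.apply_degen_one w θ
  have apply_zero := h.apply_degen_zero w θ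
  have zero_apply := h.degen_zero_apply θ w
  have skew := h.skew
  rw [skew w (degen X 1 1 θ), skew w (unitTwo X _), skew (degen X 1 0 (face X 1 1 w)),
    skew (degen X 1 0 (face X 1 2 w))] at apply_one
  rw [skew w (degen X 1 0 θ), skew w (degen X 1 1 θ),
    skew (degen X 1 0 (face X 1 0 w))] at apply_zero
  rw [skew (degen X 1 0 θ) (degen X 1 1 (face X 1 1 w)),
    skew (degen X 1 0 θ) (degen X 1 1 (face X 1 0 w))] at zero_apply
  simp only [boundary_zero_apply, boundary_one_apply, map_add, map_sub, LinearMap.add_apply,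
    LinearMap.sub_apply]
  linarith

theorem eq_coboundary (hA : tildeA X (fun _ => ω) 0 = 0) (hB : tildeB X (fun _ => ω) 0 = 0)
    (x y : X _⦋2⦌) :
    ω x y = -(ω (degen X 1 1 (face X 1 0 x)) (degen X 1 0 (face X 1 0 y))
      - ω (degen X 1 1 (face X 1 1 x)) (degen X 1 0 (face X 1 1 y))
      + ω (degen X 1 1 (face X 1 2 x)) (degen X 1 0 (face X 1 2 y))) := by
  have skew := h.skew
  have apply_unitTwo (v : X _⦋0⦌) (w : X _⦋2⦌) : ω w (unitTwo X v) = 0 :=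
    (skew _ _).trans (neg_eq_zero.mpr (LinearMap.congr_fun₂ hA v w))
  have symm_eq_zero (θ η : X _⦋1⦌) :
      ω (degen X 1 1 θ) (degen X 1 0 η) + ω (degen X 1 1 η) (degen X 1 0 θ) = 0 :=
    LinearMap.congr_fun₂ hB θ η
  have apply_one (x : X _⦋2⦌) (θ : X _⦋1⦌) : ω x (degen X 1 1 θ)
      = ω (degen X 1 1 (face X 1 1 x)) (degen X 1 0 θ)
        - ω (degen X 1 1 (face X 1 2 x)) (degen X 1 0 θ) := by
    have apply_one := h.apply_degen_one x θ
    rw [apply_unitTwo, skew (degen X 1 0 _), skew (degen X 1 0 _)] at apply_one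
    linarith [symm_eq_zero θ (face X 1 1 x), symm_eq_zero θ (face X 1 2 x)]
  have apply_zero (x : X _⦋2⦌) (θ : X _⦋1⦌) : ω x (degen X 1 0 θ)
      = ω (degen X 1 1 (face X 1 1 x)) (degen X 1 0 θ)
        - ω (degen X 1 1 (face X 1 0 x)) (degen X 1 0 θ) := by
    have apply_zero := h.apply_degen_zero x θ
    rw [apply_one, skew (degen X 1 0 _)] at apply_zero
    linarith [symm_eq_zero θ (face X 1 0 x)]
  have cocycle := h.cocycle_zero_one x y
  rw [apply_zero, skew (degen X 1 0 (face X 1 1 x)), apply_zero y,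
    skew (degen X 1 0 (face X 1 2 x))] at cocycle
  linarith [symm_eq_zero (face X 1 1 y) (face X 1 1 x), symm_eq_zero (face X 1 0 y) (face X 1 1 x),
    symm_eq_zero (face X 1 2 y) (face X 1 2 x)]

theorem exists_primitive (hA : tildeA X (fun _ => ω) 0 = 0) (hB : tildeB X (fun _ => ω) 0 = 0) :
    ∃ α : LinearMap.BilinForm ℝ (X _⦋1⦌), α.IsAlt ∧ IsNormalized X 0 (fun _ => α) ∧
      coboundary X 1 (fun _ => α) = fun _ => ω := by
  refine ⟨-(ω.compl₁₂ (degen X 1 1) (degen X 1 0)), fun θ => ?_, fun i => ?_, ?_⟩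
  · have symm_eq_zero : ω (degen X 1 1 θ) (degen X 1 0 θ) + ω (degen X 1 1 θ) (degen X 1 0 θ) = 0 :=
      LinearMap.congr_fun₂ hB θ θ
    exact neg_eq_zero.mpr (add_self_eq_zero.mp symm_eq_zero)
  · refine funext fun _ => LinearMap.ext₂ fun v w => ?_
    obtain rfl : i = 0 := Fin.fin_one_eq_zero i
    change -ω (degen X 1 1 (degen X 0 0 v)) _ = 0
    rw [degen_degen_eq_unitTwo]
    exact neg_eq_zero.mpr (LinearMap.congr_fun₂ hA v _)
  · refine funext fun _ => LinearMap.ext₂ fun x y => ?_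
    rw [coboundary_one_apply, h.eq_coboundary hA hB x y]
    simp only [LinearMap.neg_apply, LinearMap.compl₁₂_apply]
    ring

theorem formEquivalent [FiniteDimensional ℝ (X _⦋1⦌)] (h' : IsNormalizedCocycle X ω')
    (hA : tildeA X (fun _ => ω) 0 = tildeA X (fun _ => ω') 0)
    (hB : tildeB X (fun _ => ω) 0 = tildeB X (fun _ => ω') 0) :
    FormEquivalent X (fun _ => ω) (fun _ => ω') := by
  have hA' : tildeA X (fun _ => ω' - ω) 0 = 0 := LinearMap.ext₂ fun v w =>
    sub_eq_zero.mpr (LinearMap.congr_fun₂ hA v w).symm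
  have hB' : tildeB X (fun _ => ω' - ω) 0 = 0 := LinearMap.ext₂ fun θ η =>
    (sub_add_sub_comm _ _ _ _).trans (sub_eq_zero.mpr (LinearMap.congr_fun₂ hB θ η).symm)
  obtain ⟨α, alt, normalized, coboundary_eq⟩ := (h'.sub h).exists_primitive hA' hB'
  refine ⟨fun _ => α, isTwoForm_const alt, isClosedForm_const α, normalized, fun x u v => ?_,
    fun _ => ?_, fun _ => ?_⟩ <;> rw [coboundary_eq]
  exacts [rfl, hA', hB']

end IsNormalizedCocycle

theorem ConstantSymplecticTwoGroupoid.form_eq (S : ConstantSymplecticTwoGroupoid.{u}) :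
    S.ω = fun _ => S.ω 0 :=
  funext fun x => S.constant x 0

theorem ConstantSymplecticTwoGroupoid.isNormalizedCocycle (S : ConstantSymplecticTwoGroupoid.{u}) :
    IsNormalizedCocycle S.X (S.ω 0) where
  alt := S.isTwoForm.1 0
  cocycle u v := by
    have multiplicative := LinearMap.congr_fun₂ (congrFun S.multiplicative 0) u v
    simp only [coboundary_two_apply, map_zero] at multiplicative
    exact multiplicative
  normalized i a b := by
    rw [← map_zero (unitTwo S.X)]
    exact normalized_apply S.X S.normalized 0 i a b

/-! ### The 2-groupoid of isotropic data -/

namespace IsotropicData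

variable {W₁ W₀ : Type u} [AddCommGroup W₁] [Module ℝ W₁] [FiniteDimensional ℝ W₁]
  [AddCommGroup W₀] [Module ℝ W₀] (D : IsotropicData W₁ W₀)

/-- The map `∂^* : W₀^* → W₁^* ≅ W₁`. -/
def codel : Module.Dual ℝ W₀ →ₗ[ℝ] W₁ :=
  (D.pairing.toDual D.nondegenerate).symm.toLinearMap ∘ₗ D.del.dualMap

theorem pairing_codel (ξ : Module.Dual ℝ W₀) (w : W₁) : D.pairing (D.codel ξ) w = ξ (D.del w) :=
  LinearMap.BilinForm.apply_toDual_symm_apply (hB := D.nondegenerate) _ _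

theorem pairing_codel_right (ξ : Module.Dual ℝ W₀) (w : W₁) :
    D.pairing w (D.codel ξ) = ξ (D.del w) :=
  (D.symm.eq _ _).trans (D.pairing_codel ξ w)

theorem del_codel (ξ : Module.Dual ℝ W₀) : D.del (D.codel ξ) = 0 :=
  LinearMap.congr_fun D.isotropic ξ

/-- The terms of the complex `W₀^* → W₁ → W₀`. -/
def complexSpace (W₁ W₀ : Type u) [AddCommGroup W₁] [Module ℝ W₁] [AddCommGroup W₀]
    [Module ℝ W₀] (n : ℕ) : ModuleCat.{u} ℝ :=
  match n with
  | 0 => .of ℝ W₀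
  | 1 => .of ℝ W₁
  | 2 => .of ℝ (Module.Dual ℝ W₀)
  | _ + 3 => .of ℝ PUnit

/-- The differentials `∂` and `∂^*` of the complex `W₀^* → W₁ → W₀`. -/
def complexDiff (n : ℕ) : complexSpace W₁ W₀ (n + 1) ⟶ complexSpace W₁ W₀ n :=
  match n with
  | 0 => ModuleCat.ofHom D.del
  | 1 => ModuleCat.ofHom D.codel
  | _ + 2 => 0

/-- The complex `W₀^* → W₁ → W₀` in degrees `2, 1, 0`, with differentials `∂^*` and `∂`. -/
def complex : ChainComplex (ModuleCat.{u} ℝ) ℕ :=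
  ChainComplex.of (complexSpace W₁ W₀) D.complexDiff fun n => match n with
    | 0 => ModuleCat.hom_ext D.isotropic
    | _ + 1 => Limits.zero_comp

theorem complex_d (n : ℕ) : D.complex.d (n + 1) n = D.complexDiff n :=
  ChainComplex.of_d _ _ n

instance (n : ℕ) : Subsingleton (D.complex.X (n + 3)) :=
  inferInstanceAs (Subsingleton PUnit)

instance [FiniteDimensional ℝ W₀] (n : ℕ) : FiniteDimensional ℝ (D.complex.X n) :=
  match n with
  | 0 => inferInstanceAs (FiniteDimensional ℝ W₀)
  | 1 => inferInstanceAs (FiniteDimensional ℝ W₁)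
  | 2 => inferInstanceAs (FiniteDimensional ℝ (Module.Dual ℝ W₀))
  | _ + 3 => inferInstanceAs (FiniteDimensional ℝ PUnit)

/-- The simplicial vector space with normalized complex `W₀^* → W₁ → W₀`. -/
abbrev model : SVect.{u} := doldKan D.complex

/-- The linear 2-groupoid with tangent complex `W₀^* → W₁ → W₀`. -/
def modelGroupoid [FiniteDimensional ℝ W₀] : LinearTwoGroupoid.{u} where
  X := D.model
  finite _ := inferInstance
  horn_surjective q k := hornMap_surjective D.model q k
  horn_bijective q k hq := by
    obtain ⟨q, rfl⟩ := Nat.exists_eq_add_of_le' (Nat.lt_succ_iff.mp hq)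
    exact ⟨hornMap_doldKan_injective k, hornMap_surjective D.model _ k⟩

/-! ### Vertices, edges and triangles of a simplex of the model -/

variable {n : ℕ}

/-- The value in `W₀` of a simplex at its `i`-th vertex. -/
def vert (i : Fin (n + 1)) : D.model _⦋n⦌ →ₗ[ℝ] W₀ :=
  value (K := D.complex) (SimplexCategory.const ⦋0⦌ ⦋n⦌ i)

/-- The value in `W₁` of a simplex on its edge `ij`. -/
def edge (i j : Fin (n + 1)) (hij : i ≤ j := by decide) : D.model _⦋n⦌ →ₗ[ℝ] W₁ :=
  value (K := D.complex) (SimplexCategory.mkOfLe i j hij)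

/-- The value in `W₀^*` of a simplex on its triangle `ijk`. -/
def tri (i j k : Fin (n + 1)) (hij : i ≤ j := by decide) (hjk : j ≤ k := by decide) :
    D.model _⦋n⦌ →ₗ[ℝ] Module.Dual ℝ W₀ :=
  value (K := D.complex) (SimplexCategory.mkOfLeComp i j k hij hjk)

variable {D} {i j k : Fin (n + 1)} (hij : i ≤ j) (hjk : j ≤ k)

theorem vert_face (l : Fin (n + 2)) (x : D.model _⦋n + 1⦌) :
    D.vert i (face D.model n l x) = D.vert (l.succAbove i) x := rfl

theorem edge_face (l : Fin (n + 2)) (x : D.model _⦋n + 1⦌) :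
    D.edge i j hij (face D.model n l x)
      = D.edge (l.succAbove i) (l.succAbove j) (Fin.succAbove_le_succAbove_iff.mpr hij) x :=
  congrArg (value · x) (SimplexCategory.Hom.ext_one_left _ _)

theorem tri_face (l : Fin (n + 2)) (x : D.model _⦋n + 1⦌) :
    D.tri i j k hij hjk (face D.model n l x)
      = D.tri (l.succAbove i) (l.succAbove j) (l.succAbove k)
        (Fin.succAbove_le_succAbove_iff.mpr hij) (Fin.succAbove_le_succAbove_iff.mpr hjk) x :=
  congrArg (value · x) (by ext a; fin_cases a <;> rfl)

theorem vert_degen {i : Fin (n + 2)} (l : Fin (n + 1)) (x : D.model _⦋n⦌) :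
    D.vert i (degen D.model n l x) = D.vert (l.predAbove i) x := rfl

theorem edge_degen {i j : Fin (n + 2)} (hij : i ≤ j) (l : Fin (n + 1)) (x : D.model _⦋n⦌) :
    D.edge i j hij (degen D.model n l x)
      = D.edge (l.predAbove i) (l.predAbove j) (Fin.predAbove_right_monotone l hij) x :=
  congrArg (value · x) (SimplexCategory.Hom.ext_one_left _ _)

theorem tri_degen {i j k : Fin (n + 2)} (hij : i ≤ j) (hjk : j ≤ k) (l : Fin (n + 1))
    (x : D.model _⦋n⦌) :
    D.tri i j k hij hjk (degen D.model n l x)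
      = D.tri (l.predAbove i) (l.predAbove j) (l.predAbove k)
        (Fin.predAbove_right_monotone l hij) (Fin.predAbove_right_monotone l hjk) x :=
  congrArg (value · x) (by ext a; fin_cases a <;> rfl)

theorem edge_self (x : D.model _⦋n⦌) : D.edge i i le_rfl x = 0 := by
  have factor : SimplexCategory.mkOfLe i i le_rfl
      = SimplexCategory.σ 0 ≫ SimplexCategory.const ⦋0⦌ ⦋n⦌ i :=
    SimplexCategory.Hom.ext_one_left _ _
  exact (congrArg (value · x) factor).trans (value_σ_comp _ _ x)

theorem tri_self_left (x : D.model _⦋n⦌) : D.tri i i j le_rfl hij x = 0 := by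
  have factor : SimplexCategory.mkOfLeComp i i j le_rfl hij
      = SimplexCategory.σ 0 ≫ SimplexCategory.mkOfLe i j hij := by
    ext a; fin_cases a <;> rfl
  exact (congrArg (value · x) factor).trans (value_σ_comp _ _ x)

theorem tri_self_right (x : D.model _⦋n⦌) : D.tri i j j hij le_rfl x = 0 := by
  have factor : SimplexCategory.mkOfLeComp i j j hij le_rfl
      = SimplexCategory.σ 1 ≫ SimplexCategory.mkOfLe i j hij := by
    ext a; fin_cases a <;> rfl
  exact (congrArg (value · x) factor).trans (value_σ_comp _ _ x)

theorem del_edge (x : D.model _⦋n⦌) : D.del (D.edge i j hij x) = D.vert j x - D.vert i x := by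
  have d_edge := d_value (K := D.complex) (SimplexCategory.mkOfLe i j hij) x
  have face_zero : SimplexCategory.δ 0 ≫ SimplexCategory.mkOfLe i j hij
      = SimplexCategory.const ⦋0⦌ ⦋n⦌ j := SimplexCategory.Hom.ext_zero_left _ _
  have face_one : SimplexCategory.δ 1 ≫ SimplexCategory.mkOfLe i j hij
      = SimplexCategory.const ⦋0⦌ ⦋n⦌ i := SimplexCategory.Hom.ext_zero_left _ _
  rw [complex_d, Fin.sum_univ_two, face_zero, face_one] at d_edge
  simpa [sub_eq_add_neg] using! d_edge

theorem codel_tri (x : D.model _⦋n⦌) :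
    D.codel (D.tri i j k hij hjk x)
      = D.edge j k hjk x - D.edge i k (hij.trans hjk) x + D.edge i j hij x := by
  have d_tri := d_value (K := D.complex) (SimplexCategory.mkOfLeComp i j k hij hjk) x
  have face_zero : SimplexCategory.δ 0 ≫ SimplexCategory.mkOfLeComp i j k hij hjk
      = SimplexCategory.mkOfLe j k hjk := SimplexCategory.Hom.ext_one_left _ _
  have face_one : SimplexCategory.δ 1 ≫ SimplexCategory.mkOfLeComp i j k hij hjk
      = SimplexCategory.mkOfLe i k (hij.trans hjk) := SimplexCategory.Hom.ext_one_left _ _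
  have face_two : SimplexCategory.δ 2 ≫ SimplexCategory.mkOfLeComp i j k hij hjk
      = SimplexCategory.mkOfLe i j hij := SimplexCategory.Hom.ext_one_left _ _
  rw [complex_d, Fin.sum_univ_three, face_zero, face_one, face_two] at d_tri
  simpa [sub_eq_add_neg] using! d_tri

theorem tri_cocycle (x : D.model _⦋3⦌) :
    (D.tri 1 2 3) x - (D.tri 0 2 3) x + (D.tri 0 1 3) x - (D.tri 0 1 2) x = 0 := by
  have d_top := d_value (K := D.complex) (𝟙 ⦋3⦌) x
  have face_zero : SimplexCategory.δ 0 ≫ 𝟙 ⦋3⦌ = SimplexCategory.mkOfLeComp 1 2 3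
      (by decide) (by decide) := by ext a; fin_cases a <;> rfl
  have face_one : SimplexCategory.δ 1 ≫ 𝟙 ⦋3⦌ = SimplexCategory.mkOfLeComp 0 2 3
      (by decide) (by decide) := by ext a; fin_cases a <;> rfl
  have face_two : SimplexCategory.δ 2 ≫ 𝟙 ⦋3⦌ = SimplexCategory.mkOfLeComp 0 1 3
      (by decide) (by decide) := by ext a; fin_cases a <;> rfl
  have face_three : SimplexCategory.δ 3 ≫ 𝟙 ⦋3⦌ = SimplexCategory.mkOfLeComp 0 1 2
      (by decide) (by decide) := by ext a; fin_cases a <;> rfl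
  rw [Fin.sum_univ_four, face_zero, face_one, face_two, face_three,
    Subsingleton.elim (value (𝟙 ⦋3⦌) x) 0, map_zero] at d_top
  simpa [sub_eq_add_neg, pow_succ] using! d_top.symm

end IsotropicData

/-! ### The symplectic form of the model -/

namespace IsotropicData

variable {W₁ W₀ : Type u} [AddCommGroup W₁] [Module ℝ W₁] [FiniteDimensional ℝ W₁]
  [AddCommGroup W₀] [Module ℝ W₀] (D : IsotropicData W₁ W₀) {n : ℕ}

/-- The cup product of two simplices on their triangle `ijk`. Edges are multiplied by the pairing
of `W₁`, and vertices and triangles by the evaluation of `W₀^*` on `W₀`. -/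
def cup (i j k : Fin (n + 1)) (hij : i ≤ j := by decide) (hjk : j ≤ k := by decide) :
    LinearMap.BilinForm ℝ (D.model _⦋n⦌) :=
  D.pairing.compl₁₂ (D.edge i j hij) (D.edge j k hjk)
    + (D.tri i j k hij hjk).flip ∘ₗ D.vert i - (D.tri i j k hij hjk).compl₂ (D.vert k)

variable {D} {i j k : Fin (n + 1)} (hij : i ≤ j) (hjk : j ≤ k)

theorem cup_apply (x y : D.model _⦋n⦌) :
    D.cup i j k hij hjk x y = D.pairing (D.edge i j hij x) (D.edge j k hjk y)
      + D.tri i j k hij hjk y (D.vert i x) - D.tri i j k hij hjk x (D.vert k y) := rfl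

theorem cup_face (l : Fin (n + 2)) (x y : D.model _⦋n + 1⦌) :
    D.cup i j k hij hjk (face D.model n l x) (face D.model n l y)
      = D.cup (l.succAbove i) (l.succAbove j) (l.succAbove k)
        (Fin.succAbove_le_succAbove_iff.mpr hij) (Fin.succAbove_le_succAbove_iff.mpr hjk) x y := by
  simp only [cup_apply, vert_face, edge_face, tri_face]

theorem cup_degen {i j k : Fin (n + 2)} (hij : i ≤ j) (hjk : j ≤ k) (l : Fin (n + 1))
    (x y : D.model _⦋n⦌) :
    D.cup i j k hij hjk (degen D.model n l x) (degen D.model n l y)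
      = D.cup (l.predAbove i) (l.predAbove j) (l.predAbove k)
        (Fin.predAbove_right_monotone l hij) (Fin.predAbove_right_monotone l hjk) x y := by
  simp only [cup_apply, vert_degen, edge_degen, tri_degen]

theorem cup_self_left (x y : D.model _⦋n⦌) : D.cup i i j le_rfl hij x y = 0 := by
  simp [cup_apply, edge_self, tri_self_left]

theorem cup_self_right (x y : D.model _⦋n⦌) : D.cup i j j hij le_rfl x y = 0 := by
  simp [cup_apply, edge_self, tri_self_right]

theorem cup_cocycle (x y : D.model _⦋3⦌) :
    (D.cup 1 2 3) x y - (D.cup 0 2 3) x y + (D.cup 0 1 3) x y - (D.cup 0 1 2) x y = 0 := by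
  have left := D.pairing_codel ((D.tri 0 1 2) x) ((D.edge 2 3) y)
  have right := D.pairing_codel_right ((D.tri 1 2 3) y) ((D.edge 0 1) x)
  have tri_x := LinearMap.congr_fun (tri_cocycle x) ((D.vert 3) y)
  have tri_y := LinearMap.congr_fun (tri_cocycle y) ((D.vert 0) x)
  rw [codel_tri, del_edge] at left right
  simp only [cup_apply, map_add, map_sub, LinearMap.add_apply, LinearMap.sub_apply,
    LinearMap.zero_apply] at left right tri_x tri_y ⊢
  linarith

variable (D) in
/-- The symplectic form of the model: the antisymmetrized cup product. -/
def modelForm : LinearMap.BilinForm ℝ (D.model _⦋2⦌) :=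
  (1 / 2 : ℝ) • (D.cup 0 1 2 - (D.cup 0 1 2).flip)

theorem modelForm_apply (x y : D.model _⦋2⦌) :
    D.modelForm x y = 1 / 2 * ((D.cup 0 1 2) x y - (D.cup 0 1 2) y x) := rfl

theorem cup_degen_eq_zero (l : Fin 2) (x y : D.model _⦋1⦌) :
    (D.cup 0 1 2) (degen D.model 1 l x) (degen D.model 1 l y) = 0 := by
  rw [cup_degen]
  match l with
  | 0 => exact cup_self_left (i := 0) (j := 1) _ x y
  | 1 => exact cup_self_right (i := 0) (j := 1) _ x y

variable (D) in
theorem isNormalizedCocycle_modelForm : IsNormalizedCocycle D.model D.modelForm where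
  alt x := by rw [modelForm_apply, sub_self, mul_zero]
  cocycle x y := by
    simp only [modelForm_apply, cup_face]
    have cocycle_xy := cup_cocycle x y
    have cocycle_yx := cup_cocycle y x
    change 1 / 2 * ((D.cup 1 2 3) x y - (D.cup 1 2 3) y x)
      - 1 / 2 * ((D.cup 0 2 3) x y - (D.cup 0 2 3) y x)
      + 1 / 2 * ((D.cup 0 1 3) x y - (D.cup 0 1 3) y x)
      - 1 / 2 * ((D.cup 0 1 2) x y - (D.cup 0 1 2) y x) = 0
    linarith
  normalized l x y := by
    rw [modelForm_apply, cup_degen_eq_zero, cup_degen_eq_zero, sub_self, mul_zero]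

theorem modelForm_unitTwo (v : D.model _⦋0⦌) (w : D.model _⦋2⦌) :
    D.modelForm (unitTwo D.model v) w = (D.tri 0 1 2) w ((D.vert 0) v) := by
  have vert_unit (i : Fin 3) : D.vert i (unitTwo D.model v) = (D.vert 0) v := by
    fin_cases i <;> rfl
  have edge_unit (i j : Fin 3) (hij : i ≤ j) : D.edge i j hij (unitTwo D.model v) = 0 :=
    value_eq_zero_of_lt one_pos _ v
  have tri_unit : (D.tri 0 1 2) (unitTwo D.model v) = 0 := value_eq_zero_of_lt two_pos _ v
  rw [modelForm_apply, cup_apply, cup_apply]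
  simp only [edge_unit, tri_unit, vert_unit, map_zero, LinearMap.zero_apply]
  ring

theorem cup_degen_one_zero (θ η : D.model _⦋1⦌) :
    (D.cup 0 1 2) (degen D.model 1 1 θ) (degen D.model 1 0 η)
      = D.pairing ((D.edge 0 1) θ) ((D.edge 0 1) η) := by
  have tri_left : (D.tri 0 1 2) (degen D.model 1 1 θ) = 0 := value_eq_zero_of_lt one_lt_two _ θ
  have tri_right : (D.tri 0 1 2) (degen D.model 1 0 η) = 0 := value_eq_zero_of_lt one_lt_two _ η
  rw [cup_apply, tri_left, tri_right, edge_degen, edge_degen, LinearMap.zero_apply,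
    LinearMap.zero_apply, add_zero, sub_zero]
  rfl

theorem cup_degen_zero_one (θ η : D.model _⦋1⦌) :
    (D.cup 0 1 2) (degen D.model 1 0 θ) (degen D.model 1 1 η) = 0 := by
  have tri_left : (D.tri 0 1 2) (degen D.model 1 0 θ) = 0 := value_eq_zero_of_lt one_lt_two _ θ
  have tri_right : (D.tri 0 1 2) (degen D.model 1 1 η) = 0 := value_eq_zero_of_lt one_lt_two _ η
  have edge_left : (D.edge 0 1) (degen D.model 1 0 θ) = 0 :=
    (edge_degen _ 0 θ).trans (edge_self θ)
  rw [cup_apply, tri_left, tri_right, edge_left, map_zero, LinearMap.zero_apply,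
    LinearMap.zero_apply, LinearMap.zero_apply, add_zero, sub_zero]

theorem tildeB_modelForm (x : D.model _⦋0⦌) (θ η : D.model _⦋1⦌) :
    tildeB D.model (fun _ => D.modelForm) x θ η
      = D.pairing ((D.edge 0 1) θ) ((D.edge 0 1) η) := by
  have symm := D.symm.eq ((D.edge 0 1) θ) ((D.edge 0 1) η)
  change D.modelForm (degen D.model 1 1 θ) (degen D.model 1 0 η)
    + D.modelForm (degen D.model 1 1 η) (degen D.model 1 0 θ) = _
  rw [modelForm_apply, modelForm_apply, cup_degen_one_zero, cup_degen_one_zero,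
    cup_degen_zero_one, cup_degen_zero_one]
  linarith

/-! ### The marked symplectic 2-groupoid of isotropic data -/

variable (D)

theorem vert_eq_topValue : D.vert 0 = topValue (K := D.complex) 0 := by
  have top : SimplexCategory.const ⦋0⦌ ⦋0⦌ 0 = 𝟙 ⦋0⦌ := by decide
  rw [vert, top]

theorem vert_bijective : Function.Bijective (D.vert 0 : D.model _⦋0⦌ →ₗ[ℝ] W₀) := by
  rw [D.vert_eq_topValue]
  exact ⟨(injective_iff_map_eq_zero _).mpr fun _ => eq_zero_of_topValue_zero,
    topValue_surjective (K := D.complex) 0⟩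

theorem edge_eq_topValue : D.edge 0 1 = topValue (K := D.complex) 1 := by
  have top : SimplexCategory.mkOfLe (n := 1) 0 1 (by decide) = 𝟙 ⦋1⦌ := by decide
  rw [edge, top]

theorem edge_surjective : Function.Surjective (D.edge 0 1 : D.model _⦋1⦌ →ₗ[ℝ] W₁) :=
  D.edge_eq_topValue ▸ topValue_surjective (K := D.complex) 1

theorem degenerate_zero_eq_ker_edge : degenerate D.model 0 = LinearMap.ker (D.edge 0 1) :=
  D.edge_eq_topValue ▸ degenerate_doldKan

theorem tri_eq_topValue : D.tri 0 1 2 = topValue (K := D.complex) 2 := by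
  have top : SimplexCategory.mkOfLeComp (n := 2) 0 1 2 (by decide) (by decide) = 𝟙 ⦋2⦌ := by decide
  rw [tri, top]

theorem tri_surjective : Function.Surjective (D.tri 0 1 2 : D.model _⦋2⦌ →ₗ[ℝ] _) :=
  D.tri_eq_topValue ▸ topValue_surjective (K := D.complex) 2

theorem degenerate_one_eq_ker_tri : degenerate D.model 1 = LinearMap.ker (D.tri 0 1 2) :=
  D.tri_eq_topValue ▸ degenerate_doldKan

/-- The identification of the vertices of the model with `W₀`. -/
def modelMark₀ : D.model _⦋0⦌ ≃ₗ[ℝ] W₀ := .ofBijective (D.vert 0) D.vert_bijective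

/-- The identification of the degree-1 term of the tangent complex of the model with `W₁`. -/
def modelMark₁ : NormTangent D.model 0 ≃ₗ[ℝ] W₁ :=
  Submodule.quotEquivOfEq _ _ D.degenerate_zero_eq_ker_edge ≪≫ₗ
    LinearMap.quotKerEquivOfSurjective _ D.edge_surjective

variable {D}

theorem pairingB_modelForm (x : D.model _⦋0⦌) (θ η : NormTangent D.model 0) :
    pairingB D.model (fun _ => D.modelForm) D.isNormalizedCocycle_modelForm.isNormalized x θ η
      = D.pairing (D.modelMark₁ θ) (D.modelMark₁ η) := by
  obtain ⟨θ, rfl⟩ := Submodule.Quotient.mk_surjective _ θ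
  obtain ⟨η, rfl⟩ := Submodule.Quotient.mk_surjective _ η
  exact tildeB_modelForm x θ η

theorem pairingA_modelForm (x v : D.model _⦋0⦌) (w : D.model _⦋2⦌) :
    pairingA D.model (fun _ => D.modelForm) D.isNormalizedCocycle_modelForm.isNormalized x v
      (Submodule.Quotient.mk w) = (D.tri 0 1 2) w (D.modelMark₀ v) :=
  modelForm_unitTwo v w

variable (D)

theorem pairingA_modelForm_nondegenerate (x : D.model _⦋0⦌) :
    (pairingA D.model (fun _ => D.modelForm)
      D.isNormalizedCocycle_modelForm.isNormalized x).Nondegenerate := by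
  refine ⟨fun v hv => ?_, fun w hw => ?_⟩
  · refine D.modelMark₀.map_eq_zero_iff.mp ((Module.forall_dual_apply_eq_zero_iff ℝ _).mp ?_)
    intro ξ
    obtain ⟨w, rfl⟩ := D.tri_surjective ξ
    exact (pairingA_modelForm x v w).symm.trans (hv _)
  · obtain ⟨w, rfl⟩ := Submodule.Quotient.mk_surjective _ w
    rw [Submodule.Quotient.mk_eq_zero, degenerate_one_eq_ker_tri, LinearMap.mem_ker]
    refine LinearMap.ext fun v => ?_
    rw [← D.modelMark₀.apply_symm_apply v, ← pairingA_modelForm x]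
    exact hw _

theorem pairingB_modelForm_nondegenerate (x : D.model _⦋0⦌) :
    (pairingB D.model (fun _ => D.modelForm)
      D.isNormalizedCocycle_modelForm.isNormalized x).Nondegenerate := by
  have congr : pairingB D.model (fun _ => D.modelForm)
      D.isNormalizedCocycle_modelForm.isNormalized x
      = LinearMap.BilinForm.congr D.modelMark₁.symm D.pairing :=
    LinearMap.ext₂ fun θ η => pairingB_modelForm x θ η
  rw [congr]
  exact D.nondegenerate.congr _

/-- The constant symplectic 2-groupoid of isotropic data. -/
def modelSymplectic [FiniteDimensional ℝ W₀] : MarkedSymplecticTwoGroupoid W₁ W₀ where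
  toLinearTwoGroupoid := D.modelGroupoid
  ω _ := D.modelForm
  isTwoForm := isTwoForm_const D.isNormalizedCocycle_modelForm.alt
  closed := isClosedForm_const D.modelForm
  multiplicative := D.isNormalizedCocycle_modelForm.isMultiplicative
  normalized := D.isNormalizedCocycle_modelForm.isNormalized
  nondegenerate x := ⟨D.pairingA_modelForm_nondegenerate x, D.pairingB_modelForm_nondegenerate x⟩
  constant _ _ := rfl
  mark₁ := D.modelMark₁
  mark₀ := D.modelMark₀

theorem del_modelMark₁ (θ : NormTangent D.model 0) :
    D.del (D.modelMark₁ θ) = D.modelMark₀ (tangentBoundary D.model θ) := by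
  obtain ⟨θ, rfl⟩ := Submodule.Quotient.mk_surjective _ θ
  have boundary_mk : tangentBoundary D.model (Submodule.Quotient.mk θ)
      = face D.model 0 0 θ - face D.model 0 1 θ := boundary_zero_apply θ
  rw [boundary_mk, map_sub]
  exact del_edge _ θ

end IsotropicData

section Marked

variable {W₁ W₀ : Type u} [AddCommGroup W₁] [Module ℝ W₁] [AddCommGroup W₀] [Module ℝ W₀]

namespace MarkedSymplecticTwoGroupoid

variable (S : MarkedSymplecticTwoGroupoid W₁ W₀)

/-- The map `X_2 → W₀^*` induced by `A_ω`. -/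
def triMap : S.X _⦋2⦌ →ₗ[ℝ] Module.Dual ℝ W₀ :=
  (LinearMap.comp (S.ω 0) (unitTwo S.X ∘ₗ S.mark₀.symm.toLinearMap)).flip

theorem triMap_mark₀ (w : S.X _⦋2⦌) (v : S.X _⦋0⦌) :
    S.triMap w (S.mark₀ v) = S.ω 0 (unitTwo S.X v) w :=
  congrArg (fun v => S.ω 0 (unitTwo S.X v) w) (S.mark₀.symm_apply_apply v)

theorem pairingA_mk (v : S.X _⦋0⦌) (w : S.X _⦋2⦌) :
    pairingA S.X S.ω S.normalized 0 v (Submodule.Quotient.mk w) = S.triMap w (S.mark₀ v) := by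
  rw [triMap_mark₀, ← S.constant (unitTwo S.X 0)]
  rfl

theorem triMap_degen (i : Fin 2) (θ : S.X _⦋1⦌) : S.triMap (degen S.X 1 i θ) = 0 := by
  refine LinearMap.ext fun v => ?_
  obtain ⟨v, rfl⟩ := S.mark₀.surjective v
  rw [triMap_mark₀, ← degen_degen_eq_unitTwo i]
  exact S.isNormalizedCocycle.normalized i _ _

theorem triMap_surjective : Function.Surjective S.triMap := by
  intro ξ
  have hA := (S.nondegenerate 0).1
  have : (pairingA S.X S.ω S.normalized 0).IsPerfPair :=
    LinearMap.IsPerfPair.of_injective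
      (LinearMap.ker_eq_bot.mp (LinearMap.separatingLeft_iff_ker_eq_bot.mp hA.1))
      (LinearMap.ker_eq_bot.mp (LinearMap.separatingRight_iff_flip_ker_eq_bot.mp hA.2))
  obtain ⟨w, hw⟩ := Submodule.Quotient.mk_surjective _
    ((pairingA S.X S.ω S.normalized 0).flip.toPerfPair.symm (ξ ∘ₗ S.mark₀.toLinearMap))
  refine ⟨w, LinearMap.ext fun v => ?_⟩
  obtain ⟨v, rfl⟩ := S.mark₀.surjective v
  rw [← pairingA_mk, hw]
  exact LinearMap.apply_toPerfPair_flip _ _ v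

theorem ker_triMap_le : LinearMap.ker S.triMap ≤ degenerate S.X 1 := by
  intro w hw
  rw [← Submodule.Quotient.mk_eq_zero]
  refine (S.nondegenerate 0).1.2 _ fun v => ?_
  rw [pairingA_mk, LinearMap.mem_ker.mp hw, LinearMap.zero_apply]

theorem triMap_boundary (y : S.X _⦋3⦌) : S.triMap (boundary S.X 2 y) = 0 := by
  refine LinearMap.ext fun v => ?_
  obtain ⟨v, rfl⟩ := S.mark₀.surjective v
  have cocycle := S.isNormalizedCocycle.cocycle (degen S.X 2 0 (unitTwo S.X v)) y
  obtain ⟨face₀, face₁, face₂, face₃⟩ := faces_degen_zero (unitTwo S.X v)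
  rw [face₀, face₁, face₂, face₃, face_unitTwo, face_unitTwo, degen_degen_eq_unitTwo] at cocycle
  simp only [boundary_two_apply, map_add, map_sub, LinearMap.add_apply, LinearMap.sub_apply,
    triMap_mark₀]
  exact cocycle

theorem pairingB_mk (x : S.X _⦋0⦌) (θ η : S.X _⦋1⦌) :
    pairingB S.X S.ω S.normalized x (Submodule.Quotient.mk θ) (Submodule.Quotient.mk η)
      = tildeB S.X (fun _ => S.ω 0) 0 θ η := by
  rw [← S.form_eq]
  change tildeB S.X S.ω x θ η = _
  rw [S.form_eq]
  rfl

theorem pairingB_boundary (θ : S.X _⦋1⦌) (w : S.X _⦋2⦌) :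
    pairingB S.X S.ω S.normalized 0 (Submodule.Quotient.mk θ)
        (Submodule.Quotient.mk (boundary S.X 1 w))
      = S.triMap w (S.mark₀ (tangentBoundary S.X (Submodule.Quotient.mk θ))) := by
  rw [pairingB_mk, ← S.isNormalizedCocycle.tildeA_boundary, triMap_mark₀]
  rfl

/-- The form `B_ω`, transported to `W₁`. -/
def markedPairing : LinearMap.BilinForm ℝ W₁ :=
  LinearMap.BilinForm.congr S.mark₁ (pairingB S.X S.ω S.normalized 0)

/-- The map `∂`, transported to `W₁ → W₀`. -/
def markedDel : W₁ →ₗ[ℝ] W₀ :=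
  S.mark₀.toLinearMap ∘ₗ tangentBoundary S.X ∘ₗ S.mark₁.symm.toLinearMap

theorem markedPairing_mark₁ (x : S.X _⦋0⦌) (θ η : NormTangent S.X 0) :
    S.markedPairing (S.mark₁ θ) (S.mark₁ η) = pairingB S.X S.ω S.normalized x θ η := by
  rw [markedPairing, LinearMap.BilinForm.congr_apply, S.mark₁.symm_apply_apply,
    S.mark₁.symm_apply_apply]
  obtain ⟨θ, rfl⟩ := Submodule.Quotient.mk_surjective _ θ
  obtain ⟨η, rfl⟩ := Submodule.Quotient.mk_surjective _ η
  rw [S.pairingB_mk, S.pairingB_mk]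

theorem markedDel_mark₁ (θ : NormTangent S.X 0) :
    S.markedDel (S.mark₁ θ) = S.mark₀ (tangentBoundary S.X θ) :=
  congrArg (fun θ => S.mark₀ (tangentBoundary S.X θ)) (S.mark₁.symm_apply_apply θ)

theorem markedPairing_isSymm : S.markedPairing.IsSymm where
  eq w w' := by
    obtain ⟨θ, rfl⟩ := S.mark₁.surjective w
    obtain ⟨η, rfl⟩ := S.mark₁.surjective w'
    obtain ⟨θ, rfl⟩ := Submodule.Quotient.mk_surjective _ θ
    obtain ⟨η, rfl⟩ := Submodule.Quotient.mk_surjective _ η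
    rw [S.markedPairing_mark₁ 0, S.markedPairing_mark₁ 0, S.pairingB_mk, S.pairingB_mk]
    exact add_comm _ _

theorem markedPairing_nondegenerate : S.markedPairing.Nondegenerate :=
  (S.nondegenerate 0).2.congr S.mark₁

theorem markedPairing_boundary (w : S.X _⦋2⦌) (θ : W₁) :
    S.markedPairing θ (S.mark₁ (Submodule.Quotient.mk (boundary S.X 1 w)))
      = S.triMap w (S.markedDel θ) := by
  obtain ⟨θ, rfl⟩ := S.mark₁.surjective θ
  obtain ⟨θ, rfl⟩ := Submodule.Quotient.mk_surjective _ θ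
  rw [S.markedPairing_mark₁ 0, S.pairingB_boundary, S.markedDel_mark₁]

variable [FiniteDimensional ℝ W₁]

theorem toDual_symm_dualMap_triMap (w : S.X _⦋2⦌) :
    (S.markedPairing.toDual S.markedPairing_nondegenerate).symm (S.markedDel.dualMap (S.triMap w))
      = S.mark₁ (Submodule.Quotient.mk (boundary S.X 1 w)) := by
  refine (LinearEquiv.symm_apply_eq _).mpr (LinearMap.ext fun θ => ?_)
  rw [LinearMap.BilinForm.toDual_def, S.markedPairing_isSymm.eq, S.markedPairing_boundary]
  rfl

/-- The isotropic data consisting of `B_ω` and `∂`. -/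
def data : IsotropicData W₁ W₀ where
  pairing := S.markedPairing
  symm := S.markedPairing_isSymm
  nondegenerate := S.markedPairing_nondegenerate
  del := S.markedDel
  isotropic := by
    refine LinearMap.ext fun ξ => ?_
    obtain ⟨w, rfl⟩ := S.triMap_surjective ξ
    change S.markedDel ((S.markedPairing.toDual S.markedPairing_nondegenerate).symm
      (S.markedDel.dualMap (S.triMap w))) = 0
    rw [toDual_symm_dualMap_triMap, markedDel_mark₁]
    exact (congrArg S.mark₀ (boundary_boundary w)).trans (map_zero _)

/-- The identifications of `S` carry `B_ω` and `∂` to the isotropic data `D`. -/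
structure HasData (D : IsotropicData W₁ W₀) : Prop where
  pairing_mark : ∀ x θ η, D.pairing (S.mark₁ θ) (S.mark₁ η) = pairingB S.X S.ω S.normalized x θ η
  del_mark : ∀ θ, D.del (S.mark₁ θ) = S.mark₀ (tangentBoundary S.X θ)

theorem hasData_data : S.HasData S.data :=
  ⟨S.markedPairing_mark₁, S.markedDel_mark₁⟩

namespace HasData

variable {S} {D D' : IsotropicData W₁ W₀}

theorem unique (h : S.HasData D) (h' : S.HasData D') : D = D' := by
  refine IsotropicData.ext (LinearMap.ext₂ fun w w' => ?_) (LinearMap.ext fun w => ?_)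
  · obtain ⟨θ, rfl⟩ := S.mark₁.surjective w
    obtain ⟨η, rfl⟩ := S.mark₁.surjective w'
    rw [h.pairing_mark 0, h'.pairing_mark 0]
  · obtain ⟨θ, rfl⟩ := S.mark₁.surjective w
    rw [h.del_mark, h'.del_mark]

theorem codel_triMap (h : S.HasData D) (w : S.X _⦋2⦌) :
    D.codel (S.triMap w) = S.mark₁ (Submodule.Quotient.mk (boundary S.X 1 w)) := by
  rw [h.unique S.hasData_data]
  exact S.toDual_symm_dualMap_triMap w

/-- The chain map to `W₀^* → W₁ → W₀` given by the identifications and `A_ω`. -/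
def toComplex (h : S.HasData D) : NormalizedChainMap S.X D.complex where
  app n := match n with
    | 0 => S.mark₀.toLinearMap
    | 1 => S.mark₁.toLinearMap ∘ₗ (degenerate S.X 0).mkQ
    | 2 => S.triMap
    | _ + 3 => 0
  app_degen n i x := match n with
    | 0 => S.mark₁.map_eq_zero_iff.mpr
        ((Submodule.Quotient.mk_eq_zero _).mpr (degen_mem_degenerate i x))
    | 1 => S.triMap_degen i x
    | _ + 2 => rfl
  d_app n x := by
    rw [D.complex_d]
    exact match n with
    | 0 => h.del_mark _
    | 1 => h.codel_triMap x
    | 2 => (S.triMap_boundary x).symm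
    | _ + 3 => rfl

theorem isIso_toDoldKan (h : S.HasData D) : IsIso h.toComplex.toDoldKan := by
  refine h.toComplex.isIso_toDoldKan S.mark₀.bijective (fun n => ?_) fun n => ?_
  · exact match n with
    | 0 => S.mark₁.surjective.comp (Submodule.mkQ_surjective _)
    | 1 => S.triMap_surjective
    | _ + 2 => fun _ => ⟨0, Subsingleton.elim _ _⟩
  · exact match n with
    | 0 => fun θ hθ => (Submodule.Quotient.mk_eq_zero _).mp (S.mark₁.map_eq_zero_iff.mp hθ)
    | 1 => S.ker_triMap_le
    | n + 2 => le_top.trans_eq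
        (degenerate_eq_top_of_hornMap_injective (S.horn_bijective (n + 2) 0 (by omega)).1).symm

/-- The isomorphism of `S` with the model of its isotropic data. -/
def modelIso (h : S.HasData D) : S.X ≅ D.model :=
  have := h.isIso_toDoldKan
  asIso h.toComplex.toDoldKan

theorem vert_modelIso (h : S.HasData D) (v : S.X _⦋0⦌) :
    D.modelMark₀ (degreeMap h.modelIso.hom 0 v) = S.mark₀ v := by
  change (D.vert 0) (degreeMap h.modelIso.hom 0 v) = _
  rw [D.vert_eq_topValue]
  exact h.toComplex.topValue_toDoldKan v

theorem edge_modelIso (h : S.HasData D) (θ : S.X _⦋1⦌) :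
    (D.edge 0 1) (degreeMap h.modelIso.hom 1 θ) = S.mark₁ (Submodule.Quotient.mk θ) := by
  rw [D.edge_eq_topValue]
  exact h.toComplex.topValue_toDoldKan θ

theorem tri_modelIso (h : S.HasData D) (w : S.X _⦋2⦌) :
    (D.tri 0 1 2) (degreeMap h.modelIso.hom 2 w) = S.triMap w := by
  rw [D.tri_eq_topValue]
  exact h.toComplex.topValue_toDoldKan w

variable [FiniteDimensional ℝ W₀]

theorem modelIso_isEquivalence (h : S.HasData D) :
    ConstantSymplecticTwoGroupoid.IsEquivalence (S := S.toConstantSymplecticTwoGroupoid)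
      (T := D.modelSymplectic.toConstantSymplecticTwoGroupoid) h.modelIso := by
  unfold ConstantSymplecticTwoGroupoid.IsEquivalence
  rw [S.form_eq]
  refine S.isNormalizedCocycle.formEquivalent
    (D.isNormalizedCocycle_modelForm.pullback h.modelIso.hom)
    (LinearMap.ext₂ fun v w => ?_) (LinearMap.ext₂ fun θ η => ?_)
  · change _ = D.modelForm (degreeMap h.modelIso.hom 2 (unitTwo S.X v))
      (degreeMap h.modelIso.hom 2 w)
    rw [degreeMap_unitTwo, D.modelForm_unitTwo, h.tri_modelIso]
    exact (S.triMap_mark₀ w v).symm.trans (congrArg _ (h.vert_modelIso v).symm)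
  · have pairing_eq := D.tildeB_modelForm 0 (degreeMap h.modelIso.hom 1 θ)
      (degreeMap h.modelIso.hom 1 η)
    rw [h.edge_modelIso, h.edge_modelIso, h.pairing_mark 0, S.pairingB_mk] at pairing_eq
    rw [← pairing_eq]
    change D.modelForm (degen _ 1 1 _) (degen _ 1 0 _) + D.modelForm (degen _ 1 1 _) (degen _ 1 0 _)
      = _
    rw [← degreeMap_degen, ← degreeMap_degen, ← degreeMap_degen, ← degreeMap_degen]
    rfl

theorem equiv_modelSymplectic (h : S.HasData D) : S ≈ D.modelSymplectic :=
  ⟨h.modelIso, h.modelIso_isEquivalence, h.edge_modelIso, h.vert_modelIso⟩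

end HasData

end MarkedSymplecticTwoGroupoid

end Marked

section Invariance

theorem degreeMap_tangentBoundary {X Y : SVect.{u}} (φ : X ⟶ Y) (θ : X _⦋1⦌) :
    degreeMap φ 0 (tangentBoundary X (Submodule.Quotient.mk θ))
      = tangentBoundary Y (Submodule.Quotient.mk (degreeMap φ 1 θ)) := by
  change degreeMap φ 0 (boundary X 0 θ) = boundary Y 0 (degreeMap φ 1 θ)
  rw [boundary_zero_apply, boundary_zero_apply, map_sub, degreeMap_face, degreeMap_face]

theorem ConstantSymplecticTwoGroupoid.IsEquivalence.pairingB_eq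
    {S T : ConstantSymplecticTwoGroupoid.{u}} {φ : S.X ≅ T.X}
    (h : ConstantSymplecticTwoGroupoid.IsEquivalence φ) (x : S.X _⦋0⦌) (θ η : S.X _⦋1⦌) :
    pairingB T.X T.ω T.normalized (degreeMap φ.hom 0 x)
        (Submodule.Quotient.mk (degreeMap φ.hom 1 θ)) (Submodule.Quotient.mk (degreeMap φ.hom 1 η))
      = pairingB S.X S.ω S.normalized x (Submodule.Quotient.mk θ) (Submodule.Quotient.mk η) := by
  obtain ⟨α, -, -, -, sub_eq, -, tildeB_eq_zero⟩ := h
  change T.ω (unitTwo T.X _) (degen T.X 1 1 _) (degen T.X 1 0 _)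
    + T.ω (unitTwo T.X _) (degen T.X 1 1 _) (degen T.X 1 0 _)
    = S.ω (unitTwo S.X x) (degen S.X 1 1 θ) (degen S.X 1 0 η)
      + S.ω (unitTwo S.X x) (degen S.X 1 1 η) (degen S.X 1 0 θ)
  rw [← degreeMap_unitTwo, ← degreeMap_degen, ← degreeMap_degen, ← degreeMap_degen,
    ← degreeMap_degen]
  have sum_eq_zero : coboundary S.X 1 α (unitTwo S.X x) (degen S.X 1 1 θ) (degen S.X 1 0 η)
      + coboundary S.X 1 α (unitTwo S.X x) (degen S.X 1 1 η) (degen S.X 1 0 θ) = 0 :=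
    LinearMap.congr_fun₂ (tildeB_eq_zero x) θ η
  rw [← sub_eq, ← sub_eq] at sum_eq_zero
  simp only [pullback, LinearMap.compl₁₂_apply] at sum_eq_zero
  linarith

variable {W₁ W₀ : Type u} [AddCommGroup W₁] [Module ℝ W₁] [FiniteDimensional ℝ W₁]
  [AddCommGroup W₀] [Module ℝ W₀] {S T : MarkedSymplecticTwoGroupoid W₁ W₀}
  {D : IsotropicData W₁ W₀}

theorem MarkedSymplecticTwoGroupoid.HasData.of_equiv (hT : T.HasData D) (h : S ≈ T) :
    S.HasData D := by
  obtain ⟨φ, hφ, mark₁_eq, mark₀_eq⟩ := h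
  refine ⟨fun x θ η => ?_, fun θ => ?_⟩ <;>
    obtain ⟨θ, rfl⟩ := Submodule.Quotient.mk_surjective _ θ
  · obtain ⟨η, rfl⟩ := Submodule.Quotient.mk_surjective _ η
    rw [← mark₁_eq, ← mark₁_eq, ← hφ.pairingB_eq]
    exact hT.pairing_mark _ _ _
  · rw [← mark₁_eq, ← mark₀_eq, degreeMap_tangentBoundary]
    exact hT.del_mark _

variable [FiniteDimensional ℝ W₀]

theorem IsotropicData.modelSymplectic_hasData (D : IsotropicData W₁ W₀) :
    D.modelSymplectic.HasData D :=
  ⟨fun x θ η => (pairingB_modelForm x θ η).symm, D.del_modelMark₁⟩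

theorem IsotropicData.modelSymplectic_equiv_iff : D.modelSymplectic ≈ S ↔ S.HasData D :=
  ⟨fun h => D.modelSymplectic_hasData.of_equiv (Setoid.symm h),
    fun h => Setoid.symm h.equiv_modelSymplectic⟩

end Invariance

/-! ### Constant Courant algebroids and isotropic data -/

section LineDeriv

variable {V W : Type u} [AddCommGroup V] [Module ℝ V] [AddCommGroup W] [Module ℝ W]

theorem SmoothFun.linear [FiniteDimensional ℝ V] (ξ : V →ₗ[ℝ] ℝ) : SmoothFun fun x => ξ x :=
  (LinearMap.toContinuousLinearMap (ξ ∘ₗ (coords V).symm.toLinearMap)).contDiff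

theorem lineDeriv_linear_mul (ξ : V →ₗ[ℝ] ℝ) (c : ℝ) (x v : V) :
    lineDeriv ℝ (fun y => ξ y * c) x v = ξ v * c := by
  simp [lineDeriv]

theorem lineDeriv_linear (ξ : V →ₗ[ℝ] ℝ) (x v : V) : lineDeriv ℝ (fun y => ξ y) x v = ξ v := by
  simp [lineDeriv]

theorem lineDeriv_map (φ : V →ₗ[ℝ] W) {f : V → ℝ} {g : W → ℝ} (h : ∀ y, g (φ y) = f y)
    (x v : V) : lineDeriv ℝ g (φ x) (φ v) = lineDeriv ℝ f x v := by
  simp only [lineDeriv, ← h, map_add, map_smul]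

end LineDeriv

section Courant

variable {W₁ W₀ : Type u} [AddCommGroup W₁] [Module ℝ W₁]
  [AddCommGroup W₀] [Module ℝ W₀] [FiniteDimensional ℝ W₀]

namespace CourantAlgebroid

variable (E : CourantAlgebroid W₁ W₀)

theorem bracket_add_swap_bracket (e₁ e₂ e₃ : Sections W₁ W₀) :
    E.bracket (E.bracket e₁ e₂ + E.bracket e₂ e₁) e₃ = 0 := by
  rw [map_add, LinearMap.add_apply, E.jacobi, E.jacobi]
  abel

theorem anchor_eq_zero_of_bracket_eq_zero [Nontrivial W₁] {e : Sections W₁ W₀}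
    (he : ∀ e', E.bracket e e' = 0) (x : W₀) : E.anchor x (e.1 x) = 0 := by
  obtain ⟨w, hw⟩ := exists_ne (0 : W₁)
  rw [← Module.forall_dual_apply_eq_zero_iff ℝ]
  intro ξ
  have h : (0 : W₁) = ξ (E.anchor x (e.1 x)) • w + ξ x • (0 : W₁) := by
    have := E.leibniz e (Sections.const w) (fun y => ξ y) (SmoothFun.linear ξ) x
    rwa [he, he, lineDeriv_linear] at this
  rw [smul_zero, add_zero] at h
  exact (smul_eq_zero.mp h.symm).resolve_right hw

end CourantAlgebroid

namespace ConstantCourantAlgebroid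

variable (E : ConstantCourantAlgebroid W₁ W₀)

theorem pairing_bracket (e₁ e₂ : Sections W₁ W₀) (x : W₀) (w : W₁) :
    E.pairing x ((E.bracket e₁ e₂).1 x) w
      = lineDeriv ℝ (fun y => E.pairing y (e₂.1 y) w) x (E.anchor x (e₁.1 x))
        - lineDeriv ℝ (fun y => E.pairing y (e₁.1 y) w) x (E.anchor x (e₂.1 x))
        + lineDeriv ℝ (fun y => E.pairing y (e₁.1 y) (e₂.1 x)) x (E.anchor x w) := by
  have invariance₁₂ : lineDeriv ℝ (fun y => E.pairing y (e₂.1 y) w) x (E.anchor x (e₁.1 x))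
      = E.pairing x ((E.bracket e₁ e₂).1 x) w
        + E.pairing x (e₂.1 x) ((E.bracket e₁ (Sections.const w)).1 x) :=
    E.invariance e₁ e₂ (Sections.const w) x
  have skew₁ : E.pairing x ((E.bracket e₁ (Sections.const w)).1 x
        + (E.bracket (Sections.const w) e₁).1 x) (e₂.1 x)
      = lineDeriv ℝ (fun y => E.pairing y (e₁.1 y) w) x (E.anchor x (e₂.1 x)) :=
    E.skew e₁ (Sections.const w) (Sections.const (e₂.1 x)) x
  have invariance_w : lineDeriv ℝ (fun y => E.pairing y (e₁.1 y) (e₂.1 x)) x (E.anchor x w)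
      = E.pairing x ((E.bracket (Sections.const w) e₁).1 x) (e₂.1 x)
        + E.pairing x (e₁.1 x) 0 := by
    have := E.invariance (Sections.const w) e₁ (Sections.const (e₂.1 x)) x
    rwa [E.bracket_constant] at this
  have symm₂ := (E.pairing_symm x).eq ((E.bracket e₁ (Sections.const w)).1 x) (e₂.1 x)
  rw [map_add, LinearMap.add_apply] at skew₁
  rw [map_zero] at invariance_w
  linarith

theorem bracket_linear_add_swap {ξ : Module.Dual ℝ W₀} {s : W₁}
    (hs : ∀ w, E.pairing 0 s w = ξ (E.anchor 0 w)) (w : W₁) :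
    E.bracket (Sections.mulFun (fun y => ξ y) (SmoothFun.linear ξ) (Sections.const s))
        (Sections.const w)
      + E.bracket (Sections.const w)
        (Sections.mulFun (fun y => ξ y) (SmoothFun.linear ξ) (Sections.const s))
      = Sections.const (E.pairing 0 s w • s) := by
  refine Subtype.ext (funext fun x => ?_)
  rw [← sub_eq_zero]
  refine (E.pairing_nondegenerate x).1 _ fun u => ?_
  have hpair : (fun y => E.pairing y (ξ y • s) w) = fun y => ξ y * E.pairing 0 s w := by
    funext y
    rw [map_smul, E.pairing_constant y 0, LinearMap.smul_apply, smul_eq_mul]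
  have hskew := E.skew (Sections.mulFun (fun y => ξ y) (SmoothFun.linear ξ) (Sections.const s))
    (Sections.const w) (Sections.const u) x
  change E.pairing x _ u = lineDeriv ℝ (fun y => E.pairing y (ξ y • s) w) x (E.anchor x u) at hskew
  rw [hpair, lineDeriv_linear_mul] at hskew
  rw [map_sub, LinearMap.sub_apply, hskew, E.pairing_constant x 0, E.anchor_constant x 0]
  change _ - E.pairing 0 (E.pairing 0 s w • s) u = 0
  rw [map_smul, LinearMap.smul_apply, hs u, smul_eq_mul, mul_comm, sub_self]

theorem anchor_eq_zero_of_pairing {ξ : Module.Dual ℝ W₀} {s : W₁}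
    (hs : ∀ w, E.pairing 0 s w = ξ (E.anchor 0 w)) : E.anchor 0 s = 0 := by
  by_cases hs₀ : s = 0
  · rw [hs₀, map_zero]
  obtain ⟨w, hw⟩ : ∃ w, E.pairing 0 s w ≠ 0 := by
    by_contra! h
    exact hs₀ ((E.pairing_nondegenerate 0).1 s h)
  have : Nontrivial W₁ := ⟨s, 0, hs₀⟩
  -- `⟨s, w⟩ s` is `[ξ s, w] + [w, ξ s]`, whose bracket with every section vanishes.
  have hzero : E.anchor 0 (E.pairing 0 s w • s) = 0 :=
    E.anchor_eq_zero_of_bracket_eq_zero (e := Sections.const _)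
      (fun e => by rw [← E.bracket_linear_add_swap hs, E.bracket_add_swap_bracket]) 0
  rw [map_smul] at hzero
  exact (smul_eq_zero.mp hzero).resolve_left hw

end ConstantCourantAlgebroid

variable [FiniteDimensional ℝ W₁]

namespace ConstantCourantAlgebroid

variable (E : ConstantCourantAlgebroid W₁ W₀)

/-- The pairing and the anchor of a constant Courant algebroid at the origin, as the pair
`(⟨·,·⟩, ∂)`. -/
def data : IsotropicData W₁ W₀ where
  pairing := E.pairing 0
  symm := E.pairing_symm 0
  nondegenerate := E.pairing_nondegenerate 0
  del := E.anchor 0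
  isotropic := LinearMap.ext fun ξ => E.anchor_eq_zero_of_pairing (ξ := ξ) fun w =>
    LinearMap.BilinForm.apply_toDual_symm_apply (hB := E.pairing_nondegenerate 0) _ w

theorem data_pairing (x : W₀) : E.data.pairing = E.pairing x := E.pairing_constant 0 x

theorem data_del (x : W₀) : E.data.del = E.anchor x := E.anchor_constant 0 x

theorem data_injective : Function.Injective (data (W₁ := W₁) (W₀ := W₀)) := by
  intro E E' h
  have hp : E.pairing = E'.pairing := funext fun x => by
    rw [← E.data_pairing, ← E'.data_pairing, h]
  have ha : E.anchor = E'.anchor := funext fun x => by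
    rw [← E.data_del, ← E'.data_del, h]
  refine ConstantCourantAlgebroid.ext hp ha ?_
  refine LinearMap.ext fun e₁ => LinearMap.ext fun e₂ => Subtype.ext (funext fun x => ?_)
  rw [← sub_eq_zero]
  refine (E.pairing_nondegenerate x).1 _ fun w => ?_
  rw [map_sub, LinearMap.sub_apply, E.pairing_bracket, hp, ha, E'.pairing_bracket, sub_self]

end ConstantCourantAlgebroid

theorem BundledConstantCourant.isIsomorphism_of_pairing_anchor {C D : BundledConstantCourant.{u}}
    (φ₁ : C.W₁ ≃ₗ[ℝ] D.W₁) (φ₀ : C.W₀ ≃ₗ[ℝ] D.W₀)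
    (hp : ∀ x w w', D.E.pairing (φ₀ x) (φ₁ w) (φ₁ w') = C.E.pairing x w w')
    (ha : ∀ x w, D.E.anchor (φ₀ x) (φ₁ w) = φ₀ (C.E.anchor x w)) :
    IsIsomorphism φ₁ φ₀ where
  pairing := hp
  anchor := ha
  bracket e₁ e₂ e₁' e₂' h₁ h₂ x := by
    have lineDeriv_pairing : ∀ (e : Sections C.W₁ C.W₀) (e' : Sections D.W₁ D.W₀) (u : C.W₁)
        (v : C.W₀), (∀ x, e'.1 (φ₀ x) = φ₁ (e.1 x)) →
        lineDeriv ℝ (fun y => D.E.pairing y (e'.1 y) (φ₁ u)) (φ₀ x) (φ₀ v)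
          = lineDeriv ℝ (fun y => C.E.pairing y (e.1 y) u) x v := fun e e' u v he =>
      lineDeriv_map φ₀.toLinearMap (fun y => by rw [LinearEquiv.coe_coe, he, hp]) x v
    rw [← sub_eq_zero]
    refine (D.E.pairing_nondegenerate (φ₀ x)).1 _ fun w' => ?_
    obtain ⟨w, rfl⟩ := φ₁.surjective w'
    rw [map_sub, LinearMap.sub_apply, hp, C.E.pairing_bracket, D.E.pairing_bracket, h₁, h₂,
      ha, ha, ha, lineDeriv_pairing e₂ e₂' _ _ h₂, lineDeriv_pairing e₁ e₁' _ _ h₁,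
      lineDeriv_pairing e₁ e₁' _ _ h₁, sub_self]

end Courant

/-! ### The Courant algebroid of isotropic data -/

section Existence

open scoped ContDiff

variable {W₁ W₀ : Type u} [NormedAddCommGroup W₁] [NormedSpace ℝ W₁] [FiniteDimensional ℝ W₁]
  [NormedAddCommGroup W₀] [NormedSpace ℝ W₀]

namespace IsotropicData

variable (D : IsotropicData W₁ W₀)

/-- The pairing as a continuous bilinear map. -/
def pairingCLM : W₁ →L[ℝ] W₁ →L[ℝ] ℝ :=
  LinearMap.toContinuousLinearMap (LinearMap.toContinuousLinearMap.toLinearMap ∘ₗ D.pairing)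

/-- The map `∂` as a continuous linear map. -/
def delCLM : W₁ →L[ℝ] W₀ := LinearMap.toContinuousLinearMap D.del

variable {D}

theorem pairingCLM_comm (w w' : W₁) : D.pairingCLM w w' = D.pairingCLM w' w := D.symm.eq w w'

variable (D) in
theorem eq_of_pairingCLM {w w' : W₁} (h : ∀ u, D.pairingCLM w u = D.pairingCLM w' u) :
    w = w' :=
  (D.pairing.toDual D.nondegenerate).injective (LinearMap.ext h)

end IsotropicData

variable [FiniteDimensional ℝ W₀]

theorem smoothFun_iff_contDiff {f : W₀ → ℝ} : SmoothFun f ↔ ContDiff ℝ ∞ f :=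
  (coords W₀).symm.toContinuousLinearEquiv.contDiff_comp_iff

theorem smoothMap_iff_contDiff {e : W₀ → W₁} : SmoothMap e ↔ ContDiff ℝ ∞ e := by
  refine ⟨fun h => ?_, fun h ξ => smoothFun_iff_contDiff.mpr
    ((LinearMap.toContinuousLinearMap ξ).contDiff.comp h)⟩
  rw [← (coords W₁).toContinuousLinearEquiv.comp_contDiff_iff]
  exact contDiff_pi.mpr fun i =>
    smoothFun_iff_contDiff.mp (h (LinearMap.proj i ∘ₗ (coords W₁).toLinearMap))

namespace Sections

theorem contDiff (e : Sections W₁ W₀) : ContDiff ℝ ∞ e.1 := smoothMap_iff_contDiff.mp e.2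

theorem differentiableAt (e : Sections W₁ W₀) (x : W₀) : DifferentiableAt ℝ e.1 x :=
  (contDiff e).differentiable (by simp) x

theorem contDiff_fderiv (e : Sections W₁ W₀) : ContDiff ℝ ∞ (fderiv ℝ e.1) :=
  (contDiff e).fderiv_right (by simp)

theorem differentiableAt_fderiv (e : Sections W₁ W₀) (x : W₀) :
    DifferentiableAt ℝ (fderiv ℝ e.1) x :=
  (contDiff_fderiv e).differentiable (by simp) x

theorem fderiv_fderiv_comm (e : Sections W₁ W₀) (x u v : W₀) :
    fderiv ℝ (fderiv ℝ e.1) x u v = fderiv ℝ (fderiv ℝ e.1) x v u :=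
  ((contDiff e).contDiffAt.isSymmSndFDerivAt
    (by rw [minSmoothness_of_isRCLikeNormedField]; exact ENat.LEInfty.out)).eq u v

end Sections

namespace IsotropicData

variable (D : IsotropicData W₁ W₀)

/-- The map `∂^*` on the continuous dual of `W₀`. -/
def codelCLM : (W₀ →L[ℝ] ℝ) →L[ℝ] W₁ :=
  LinearMap.toContinuousLinearMap (D.codel ∘ₗ LinearMap.toContinuousLinearMap.symm.toLinearMap)

variable {D}

theorem pairingCLM_codelCLM (ξ : W₀ →L[ℝ] ℝ) (w : W₁) :
    D.pairingCLM (D.codelCLM ξ) w = ξ (D.delCLM w) :=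
  D.pairing_codel ξ.toLinearMap w

theorem delCLM_codelCLM (ξ : W₀ →L[ℝ] ℝ) : D.delCLM (D.codelCLM ξ) = 0 :=
  D.del_codel ξ.toLinearMap

variable (D)

/-- The bracket `[e₁, e₂] = De₂(∂e₁) - De₁(∂e₂) + ∂^*⟨De₁(·), e₂⟩` of sections. -/
def bracketSection (e₁ e₂ : Sections W₁ W₀) : Sections W₁ W₀ :=
  ⟨fun x => fderiv ℝ e₂.1 x (D.delCLM (e₁.1 x)) - fderiv ℝ e₁.1 x (D.delCLM (e₂.1 x))
      + D.codelCLM ((D.pairingCLM.flip (e₂.1 x)).comp (fderiv ℝ e₁.1 x)),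
    smoothMap_iff_contDiff.mpr <| by
      have contDiff_left := Sections.contDiff e₁
      have contDiff_right := Sections.contDiff e₂
      fun_prop⟩

variable {D}

theorem pairing_bracketSection (e₁ e₂ : Sections W₁ W₀) (x : W₀) (w : W₁) :
    D.pairingCLM ((D.bracketSection e₁ e₂).1 x) w
      = D.pairingCLM (fderiv ℝ e₂.1 x (D.delCLM (e₁.1 x))) w
        - D.pairingCLM (fderiv ℝ e₁.1 x (D.delCLM (e₂.1 x))) w
        + D.pairingCLM (fderiv ℝ e₁.1 x (D.delCLM w)) (e₂.1 x) := by
  rw [bracketSection, map_add, map_sub, _root_.add_apply, _root_.sub_apply, pairingCLM_codelCLM]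
  rfl

theorem delCLM_bracketSection (e₁ e₂ : Sections W₁ W₀) (x : W₀) :
    D.delCLM ((D.bracketSection e₁ e₂).1 x)
      = D.delCLM (fderiv ℝ e₂.1 x (D.delCLM (e₁.1 x)))
        - D.delCLM (fderiv ℝ e₁.1 x (D.delCLM (e₂.1 x))) := by
  rw [bracketSection, map_add, map_sub, delCLM_codelCLM, add_zero]

theorem pairing_fderiv_bracketSection (e₁ e₂ : Sections W₁ W₀) (x v : W₀) (w : W₁) :
    D.pairingCLM (fderiv ℝ (D.bracketSection e₁ e₂).1 x v) w
      = D.pairingCLM (fderiv ℝ e₂.1 x (D.delCLM (fderiv ℝ e₁.1 x v))) w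
        + D.pairingCLM (fderiv ℝ (fderiv ℝ e₂.1) x v (D.delCLM (e₁.1 x))) w
        - (D.pairingCLM (fderiv ℝ e₁.1 x (D.delCLM (fderiv ℝ e₂.1 x v))) w
          + D.pairingCLM (fderiv ℝ (fderiv ℝ e₁.1) x v (D.delCLM (e₂.1 x))) w)
        + (D.pairingCLM (fderiv ℝ (fderiv ℝ e₁.1) x v (D.delCLM w)) (e₂.1 x)
          + D.pairingCLM (fderiv ℝ e₁.1 x (D.delCLM w)) (fderiv ℝ e₂.1 x v)) := by
  have h₁ := (Sections.differentiableAt e₁ x).hasFDerivAt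
  have h₂ := (Sections.differentiableAt e₂ x).hasFDerivAt
  have h₁' := (Sections.differentiableAt_fderiv e₁ x).hasFDerivAt
  have h₂' := (Sections.differentiableAt_fderiv e₂ x).hasFDerivAt
  have hasFDerivAt_bracket := ((h₂'.clm_apply (D.delCLM.hasFDerivAt.comp x h₁)).sub
    (h₁'.clm_apply (D.delCLM.hasFDerivAt.comp x h₂))).add
    (D.codelCLM.hasFDerivAt.comp x ((D.pairingCLM.flip.hasFDerivAt.comp x h₂).clm_comp h₁'))
  have fderiv_bracket : fderiv ℝ (D.bracketSection e₁ e₂).1 x = _ := hasFDerivAt_bracket.fderiv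
  rw [fderiv_bracket]
  simp [pairingCLM_codelCLM]

theorem bracketSection_jacobi (a b c : Sections W₁ W₀) :
    D.bracketSection (D.bracketSection a b) c
      = D.bracketSection a (D.bracketSection b c) - D.bracketSection b (D.bracketSection a c) := by
  refine Subtype.ext (funext fun x => D.eq_of_pairingCLM fun d => ?_)
  change _ = D.pairingCLM ((D.bracketSection a (D.bracketSection b c)).1 x
    - (D.bracketSection b (D.bracketSection a c)).1 x) d
  rw [map_sub, _root_.sub_apply, pairing_bracketSection _ c,
    pairing_bracketSection a (D.bracketSection b c),
    pairing_bracketSection b (D.bracketSection a c)]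
  simp only [delCLM_bracketSection, pairing_fderiv_bracketSection, map_sub, _root_.sub_apply]
  rw [pairingCLM_comm _ ((D.bracketSection b c).1 x),
    pairingCLM_comm _ ((D.bracketSection a c).1 x), pairing_bracketSection,
    pairing_bracketSection]
  -- What remains cancels by the symmetry of the second derivatives and of the pairing.
  rw [Sections.fderiv_fderiv_comm a x (D.delCLM (c.1 x)) (D.delCLM d),
    Sections.fderiv_fderiv_comm a x (D.delCLM (c.1 x)) (D.delCLM (b.1 x)),
    Sections.fderiv_fderiv_comm a x (D.delCLM d) (D.delCLM (b.1 x)),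
    Sections.fderiv_fderiv_comm b x (D.delCLM (c.1 x)) (D.delCLM (a.1 x)),
    Sections.fderiv_fderiv_comm b x (D.delCLM d) (D.delCLM (a.1 x)),
    Sections.fderiv_fderiv_comm c x (D.delCLM (a.1 x)) (D.delCLM (b.1 x)),
    pairingCLM_comm (fderiv ℝ c.1 x (D.delCLM (b.1 x))) (fderiv ℝ a.1 x (D.delCLM d)),
    pairingCLM_comm (fderiv ℝ c.1 x (D.delCLM (a.1 x))) (fderiv ℝ b.1 x (D.delCLM d)),
    pairingCLM_comm (fderiv ℝ b.1 x (D.delCLM (c.1 x))) (fderiv ℝ a.1 x (D.delCLM d))]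
  ring

theorem lineDeriv_pairing (e e' : Sections W₁ W₀) (x v : W₀) :
    lineDeriv ℝ (fun y => D.pairing (e.1 y) (e'.1 y)) x v
      = D.pairingCLM (e.1 x) (fderiv ℝ e'.1 x v) + D.pairingCLM (fderiv ℝ e.1 x v) (e'.1 x) :=
  ((D.pairingCLM.hasFDerivAt.comp x (Sections.differentiableAt e x).hasFDerivAt).clm_apply
    (Sections.differentiableAt e' x).hasFDerivAt).hasLineDerivAt v |>.lineDeriv

theorem bracketSection_mulFun (e₁ e₂ : Sections W₁ W₀) {f : W₀ → ℝ} (hf : SmoothFun f) (x : W₀) :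
    (D.bracketSection e₁ (Sections.mulFun f hf e₂)).1 x
      = lineDeriv ℝ f x (D.delCLM (e₁.1 x)) • e₂.1 x + f x • (D.bracketSection e₁ e₂).1 x := by
  have hf' := (smoothFun_iff_contDiff.mp hf).differentiable (by simp) x
  have fderiv_mul : fderiv ℝ (Sections.mulFun f hf e₂).1 x
      = f x • fderiv ℝ e₂.1 x + (fderiv ℝ f x).smulRight (e₂.1 x) :=
    fderiv_fun_smul hf' (Sections.differentiableAt e₂ x)
  have mul_val : (Sections.mulFun f hf e₂).1 x = f x • e₂.1 x := rfl
  rw [hf'.lineDeriv_eq_fderiv]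
  refine D.eq_of_pairingCLM fun d => ?_
  simp only [pairing_bracketSection, fderiv_mul, mul_val, map_add, map_smul,
    _root_.add_apply, _root_.smul_apply, ContinuousLinearMap.smulRight_apply, smul_eq_mul]
  ring

theorem lineDeriv_pairing_anchor (e₁ e₂ e₃ : Sections W₁ W₀) (x : W₀) :
    lineDeriv ℝ (fun y => D.pairing (e₂.1 y) (e₃.1 y)) x (D.delCLM (e₁.1 x))
      = D.pairingCLM ((D.bracketSection e₁ e₂).1 x) (e₃.1 x)
        + D.pairingCLM (e₂.1 x) ((D.bracketSection e₁ e₃).1 x) := by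
  rw [lineDeriv_pairing, pairingCLM_comm (e₂.1 x), pairingCLM_comm (e₂.1 x),
    pairing_bracketSection, pairing_bracketSection]
  ring

theorem pairing_bracketSection_add_swap (e₁ e₂ : Sections W₁ W₀) (x : W₀) (w : W₁) :
    D.pairingCLM ((D.bracketSection e₁ e₂).1 x + (D.bracketSection e₂ e₁).1 x) w
      = lineDeriv ℝ (fun y => D.pairing (e₁.1 y) (e₂.1 y)) x (D.delCLM w) := by
  rw [lineDeriv_pairing, map_add, _root_.add_apply, pairing_bracketSection,
    pairing_bracketSection, pairingCLM_comm (e₁.1 x)]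
  ring

theorem bracketSection_const (w w' : W₁) :
    D.bracketSection (Sections.const w) (Sections.const w') = 0 := by
  have fderiv_const : ∀ (u : W₁) (x : W₀), fderiv ℝ (Sections.const (W₀ := W₀) u).1 x = 0 :=
    fun u _ => fderiv_const_apply u
  refine Subtype.ext (funext fun x => ?_)
  simp [bracketSection, fderiv_const]

variable (D)

/-- The bracket of sections as a bilinear map. -/
def bracketLinear : Sections W₁ W₀ →ₗ[ℝ] Sections W₁ W₀ →ₗ[ℝ] Sections W₁ W₀ := by
  have fderiv_add_sections : ∀ (e e' : Sections W₁ W₀) (x : W₀),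
      fderiv ℝ (e.1 + e'.1) x = fderiv ℝ e.1 x + fderiv ℝ e'.1 x := fun e e' x =>
    fderiv_add (Sections.differentiableAt e x) (Sections.differentiableAt e' x)
  have fderiv_smul_section : ∀ (c : ℝ) (e : Sections W₁ W₀) (x : W₀),
      fderiv ℝ (c • e.1) x = c • fderiv ℝ e.1 x := fun c e x =>
    fderiv_const_smul (Sections.differentiableAt e x) c
  refine LinearMap.mk₂ ℝ D.bracketSection ?_ ?_ ?_ ?_
  all_goals
    intro p q r
    refine Subtype.ext (funext fun x => D.eq_of_pairingCLM fun d => ?_)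
    simp only [Submodule.coe_add, Submodule.coe_smul, Pi.add_apply, Pi.smul_apply,
      fderiv_add_sections, fderiv_smul_section, pairing_bracketSection, map_add, map_smul,
      _root_.add_apply, _root_.smul_apply, smul_eq_mul]
    ring

/-- The constant Courant algebroid with pairing `⟨·,·⟩` and anchor `∂`. The norms on `W₁` and `W₀`
only serve to differentiate sections. -/
def courantAlgebroid : ConstantCourantAlgebroid W₁ W₀ where
  pairing _ := D.pairing
  anchor _ := D.del
  bracket := D.bracketLinear
  pairing_smooth _ _ := SmoothFun.const _
  pairing_symm _ := D.symm
  pairing_nondegenerate _ := D.nondegenerate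
  anchor_smooth _ _ := SmoothFun.const _
  leibniz e₁ e₂ _ hf x := bracketSection_mulFun e₁ e₂ hf x
  invariance := lineDeriv_pairing_anchor
  jacobi := bracketSection_jacobi
  skew e₁ e₂ e x := pairing_bracketSection_add_swap e₁ e₂ x (e.1 x)
  pairing_constant _ _ := rfl
  anchor_constant _ _ := rfl
  bracket_constant := bracketSection_const

end IsotropicData

end Existence

section DataEquiv

variable {W₁ W₀ : Type u} [AddCommGroup W₁] [Module ℝ W₁] [FiniteDimensional ℝ W₁]
  [AddCommGroup W₀] [Module ℝ W₀] [FiniteDimensional ℝ W₀]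

namespace ConstantCourantAlgebroid

theorem data_surjective : Function.Surjective (data (W₁ := W₁) (W₀ := W₀)) := by
  intro D
  let _ : NormedAddCommGroup W₁ :=
    NormedAddCommGroup.induced W₁ _ (coords W₁) (coords W₁).injective
  let _ : NormedSpace ℝ W₁ := NormedSpace.induced ℝ W₁ _ (coords W₁)
  let _ : NormedAddCommGroup W₀ :=
    NormedAddCommGroup.induced W₀ _ (coords W₀) (coords W₀).injective
  let _ : NormedSpace ℝ W₀ := NormedSpace.induced ℝ W₀ _ (coords W₀)
  exact ⟨D.courantAlgebroid, rfl⟩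

/-- Constant Courant algebroid structures on `W₁ × W₀ → W₀` correspond to pairs `(⟨·,·⟩, ∂)`. -/
def dataEquiv : ConstantCourantAlgebroid W₁ W₀ ≃ IsotropicData W₁ W₀ :=
  Equiv.ofBijective (data (W₁ := W₁) (W₀ := W₀)) ⟨data_injective, data_surjective⟩

end ConstantCourantAlgebroid

end DataEquiv

/-! ### The classification -/

section Classification

variable {W₁ W₀ : Type u} [AddCommGroup W₁] [Module ℝ W₁] [FiniteDimensional ℝ W₁]
  [AddCommGroup W₀] [Module ℝ W₀] [FiniteDimensional ℝ W₀]

/-- The classification of constant symplectic 2-groupoids with identified tangent complex by their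
isotropic data. -/
def IsotropicData.symplecticClassEquiv :
    IsotropicData W₁ W₀ ≃ Quotient (MarkedSymplecticTwoGroupoid.setoid W₁ W₀) :=
  Equiv.ofBijective (fun D => ⟦D.modelSymplectic⟧)
    ⟨fun _ D' h => (modelSymplectic_equiv_iff.mp (Quotient.exact h)).unique
        D'.modelSymplectic_hasData,
      Quotient.ind fun S => ⟨S.data, Quotient.sound (modelSymplectic_equiv_iff.mpr S.hasData_data)⟩⟩

theorem IsotropicData.symplecticClassEquiv_eq_mk_iff {D : IsotropicData W₁ W₀}
    {S : MarkedSymplecticTwoGroupoid W₁ W₀} : D.symplecticClassEquiv = ⟦S⟧ ↔ S.HasData D :=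
  Quotient.eq.trans modelSymplectic_equiv_iff

end Classification

section TangentEquiv

variable {X Y : SVect.{u}}

theorem degreeMap_mem_degenerate (φ : X ⟶ Y) {n : ℕ} {x : X _⦋n + 1⦌} (hx : x ∈ degenerate X n) :
    degreeMap φ (n + 1) x ∈ degenerate Y n := by
  suffices degenerate X n ≤ (degenerate Y n).comap (degreeMap φ (n + 1)) from this hx
  refine iSup_le fun i => ?_
  rintro _ ⟨v, rfl⟩
  rw [Submodule.mem_comap, degreeMap_degen]
  exact degen_mem_degenerate i _

theorem map_degenerate (φ : X ≅ Y) (n : ℕ) :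
    (degenerate X n).map (φ.app (op ⦋n + 1⦌)).toLinearEquiv.toLinearMap = degenerate Y n := by
  refine le_antisymm (Submodule.map_le_iff_le_comap.mpr fun _ hx =>
    degreeMap_mem_degenerate φ.hom hx) fun y hy => ?_
  exact ⟨degreeMap φ.inv (n + 1) y, degreeMap_mem_degenerate φ.inv hy,
    (φ.app (op ⦋n + 1⦌)).toLinearEquiv.apply_symm_apply y⟩

/-- The map induced on the normalized complex by an isomorphism of simplicial vector spaces. -/
def normTangentEquiv (φ : X ≅ Y) (n : ℕ) : NormTangent X n ≃ₗ[ℝ] NormTangent Y n :=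
  Submodule.Quotient.equiv _ _ (φ.app (op ⦋n + 1⦌)).toLinearEquiv (map_degenerate φ n)

end TangentEquiv

theorem corresponds_iff_exists_hasData {C : BundledConstantCourant.{u}}
    {S : ConstantSymplecticTwoGroupoid.{u}} :
    Corresponds C S ↔ ∃ T : MarkedSymplecticTwoGroupoid C.W₁ C.W₀,
      T.toConstantSymplecticTwoGroupoid = S ∧ T.HasData C.E.data := by
  constructor
  · rintro ⟨φ₁, φ₀, pairing_eq, anchor_eq⟩
    refine ⟨{ S with mark₁ := φ₁, mark₀ := φ₀ }, rfl, fun x θ η => ?_, anchor_eq 0⟩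
    rw [C.E.data_pairing (φ₀ x)]
    exact pairing_eq x θ η
  · rintro ⟨T, rfl, hT⟩
    refine ⟨T.mark₁, T.mark₀, fun x θ η => ?_, fun x θ => ?_⟩
    · rw [← C.E.data_pairing]
      exact hT.pairing_mark x θ η
    · rw [← C.E.data_del]
      exact hT.del_mark θ

namespace BundledConstantCourant

/-- The constant symplectic 2-groupoid of a constant Courant algebroid. -/
def symplectic (C : BundledConstantCourant.{u}) : ConstantSymplecticTwoGroupoid.{u} :=
  C.E.data.modelSymplectic.toConstantSymplecticTwoGroupoid

theorem corresponds_symplectic (C : BundledConstantCourant.{u}) : Corresponds C C.symplectic :=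
  corresponds_iff_exists_hasData.mpr ⟨_, rfl, C.E.data.modelSymplectic_hasData⟩

end BundledConstantCourant

namespace Corresponds

variable {C D : BundledConstantCourant.{u}} {S T : ConstantSymplecticTwoGroupoid.{u}}

theorem equiv_symplectic (h : Corresponds C S) : S ≈ C.symplectic := by
  obtain ⟨T, rfl, hT⟩ := corresponds_iff_exists_hasData.mp h
  obtain ⟨φ, hφ, -, -⟩ := hT.equiv_modelSymplectic
  exact ⟨φ, hφ⟩

theorem of_isomorphic (h : Corresponds C S) (e : C ≈ D) : Corresponds D S := by
  obtain ⟨φ₁, φ₀, pairing_eq, anchor_eq⟩ := h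
  obtain ⟨ψ₁, ψ₀, hψ⟩ := e
  refine ⟨φ₁.trans ψ₁, φ₀.trans ψ₀, fun x θ η => (hψ.pairing _ _ _).trans (pairing_eq x θ η),
    fun x θ => ?_⟩
  obtain ⟨x, rfl⟩ := ψ₀.surjective x
  exact (hψ.anchor _ _).trans (congrArg ψ₀ (anchor_eq x θ))

theorem isomorphic (h : Corresponds C S) (k : Corresponds D S) : C ≈ D := by
  obtain ⟨φ₁, φ₀, pairing_eq, anchor_eq⟩ := h
  obtain ⟨ψ₁, ψ₀, pairing_eq', anchor_eq'⟩ := k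
  refine ⟨φ₁.symm.trans ψ₁, φ₀.symm.trans ψ₀,
    BundledConstantCourant.isIsomorphism_of_pairing_anchor _ _ (fun x w w' => ?_) fun x w => ?_⟩
  · obtain ⟨x, rfl⟩ := φ₀.surjective x
    obtain ⟨θ, rfl⟩ := φ₁.surjective w
    obtain ⟨η, rfl⟩ := φ₁.surjective w'
    simp only [LinearEquiv.trans_apply, LinearEquiv.symm_apply_apply]
    rw [pairing_eq, pairing_eq']
  · obtain ⟨θ, rfl⟩ := φ₁.surjective w
    simp only [LinearEquiv.trans_apply, LinearEquiv.symm_apply_apply]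
    rw [anchor_eq, anchor_eq', φ₀.symm_apply_apply]

theorem of_equiv (h : Corresponds C T) (e : S ≈ T) : Corresponds C S := by
  obtain ⟨T, rfl, hT⟩ := corresponds_iff_exists_hasData.mp h
  obtain ⟨φ, hφ⟩ := e
  let S' : MarkedSymplecticTwoGroupoid C.W₁ C.W₀ :=
    { S with
      mark₁ := (normTangentEquiv φ 0).trans T.mark₁
      mark₀ := (φ.app (op ⦋0⦌)).toLinearEquiv.trans T.mark₀ }
  have equiv : S' ≈ T := ⟨φ, hφ, fun _ => rfl, fun _ => rfl⟩
  exact corresponds_iff_exists_hasData.mpr ⟨S', rfl, hT.of_equiv equiv⟩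

end Corresponds

theorem BundledConstantCourant.symplectic_equiv_iff {C : BundledConstantCourant.{u}}
    {S : ConstantSymplecticTwoGroupoid.{u}} : C.symplectic ≈ S ↔ Corresponds C S :=
  ⟨fun h => C.corresponds_symplectic.of_equiv (Setoid.symm h),
    fun h => Setoid.symm h.equiv_symplectic⟩

theorem exists_corresponds (S : ConstantSymplecticTwoGroupoid.{u}) :
    ∃ C : BundledConstantCourant.{u}, Corresponds C S := by
  let T : MarkedSymplecticTwoGroupoid (NormTangent S.X 0) (S.X _⦋0⦌) :=
    { S with mark₁ := LinearEquiv.refl ℝ _, mark₀ := LinearEquiv.refl ℝ _ }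
  obtain ⟨E, hE⟩ := ConstantCourantAlgebroid.data_surjective T.data
  have hT : T.HasData E.data := hE ▸ T.hasData_data
  exact ⟨⟨_, _, E⟩, corresponds_iff_exists_hasData.mpr ⟨T, rfl, hT⟩⟩

/-- The bijection between isomorphism classes of constant Courant algebroids and equivalence classes
of constant symplectic 2-groupoids. -/
def courantClassEquiv : Quotient BundledConstantCourant.setoid.{u} ≃
    Quotient ConstantSymplecticTwoGroupoid.setoid.{u} :=
  Equiv.ofBijective
    (Quotient.map BundledConstantCourant.symplectic fun _ D h =>
      BundledConstantCourant.symplectic_equiv_iff.mpr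
        (D.corresponds_symplectic.of_isomorphic (Setoid.symm h)))
    ⟨Quotient.ind₂ fun _ D h => Quotient.sound
        ((BundledConstantCourant.symplectic_equiv_iff.mp (Quotient.exact h)).isomorphic
          D.corresponds_symplectic),
      Quotient.ind fun S =>
        let ⟨C, hC⟩ := exists_corresponds S
        ⟨⟦C⟧, Quotient.sound (BundledConstantCourant.symplectic_equiv_iff.mpr hC)⟩⟩

theorem courantClassEquiv_mk_eq_mk_iff {C : BundledConstantCourant.{u}}
    {S : ConstantSymplecticTwoGroupoid.{u}} : courantClassEquiv ⟦C⟧ = ⟦S⟧ ↔ Corresponds C S :=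
  (Quotient.eq (x := C.symplectic)).trans BundledConstantCourant.symplectic_equiv_iff

end ConstantCourant

end

open ConstantCourant

theorem theorem4p3 :
    (∀ (W₁ W₀ : Type u) [AddCommGroup W₁] [Module ℝ W₁] [FiniteDimensional ℝ W₁]
      [AddCommGroup W₀] [Module ℝ W₀] [FiniteDimensional ℝ W₀],
      ∃ (F : ConstantCourantAlgebroid W₁ W₀ ≃ IsotropicData W₁ W₀)
        (G : IsotropicData W₁ W₀ ≃ Quotient (MarkedSymplecticTwoGroupoid.setoid W₁ W₀)),
        (∀ E x, (F E).pairing = E.pairing x ∧ (F E).del = E.anchor x) ∧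
        ∀ (D : IsotropicData W₁ W₀) (S : MarkedSymplecticTwoGroupoid W₁ W₀), G D = ⟦S⟧ ↔
          (∀ x θ η, D.pairing (S.mark₁ θ) (S.mark₁ η) = pairingB S.X S.ω S.normalized x θ η) ∧
          ∀ θ, D.del (S.mark₁ θ) = S.mark₀ (tangentBoundary S.X θ)) ∧
    ∃ H : Quotient BundledConstantCourant.setoid.{u} ≃
        Quotient ConstantSymplecticTwoGroupoid.setoid.{u},
      ∀ (C : BundledConstantCourant.{u}) (S : ConstantSymplecticTwoGroupoid.{u}),
        H ⟦C⟧ = ⟦S⟧ ↔ Corresponds C S :=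
  ⟨fun _ _ => ⟨ConstantCourantAlgebroid.dataEquiv, IsotropicData.symplecticClassEquiv,
      fun E x => ⟨E.data_pairing x, E.data_del x⟩,
      fun _ _ => IsotropicData.symplecticClassEquiv_eq_mk_iff.trans
        ⟨fun ⟨hp, hd⟩ => ⟨hp, hd⟩, fun ⟨hp, hd⟩ => ⟨hp, hd⟩⟩⟩,
    courantClassEquiv, fun _ _ => courantClassEquiv_mk_eq_mk_iff⟩
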